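/- Identify a linear map $\mathcal{L}:\mathbb{R}^{q\times q}\to\mathbb{R}^d$ with its component matrices $\mathcal{L}_1,\dots,\mathcal{L}_d\in\mathbb{R}^{q\times q}$, where $\mathcal{L}(X)_i=\langle \mathcal{L}_i,X\rangle=\mathrm{tr}(\mathcal{L}_i'X)$. Call $\mathcal{L}$ normalized if $\sum_{i=1}^d\mathcal{L}_i\mathcal{L}_i'=qI$ and $\sum_{i=1}^d\mathcal{L}_i'\mathcal{L}_i=qI$. A positive-definite rank-preserver is a linear operator on $\mathbb{R}^{q\times q}$ of the form $\mathcal{N}(X)=P_1XP_2$ with $P_1,P_2$ symmetric positive definite. For $k\ge 1$, $\delta_k(\mathcal{L})$ denotes the smallest $\delta'$ such that $(1-\delta')\|X\|_F^2\le\|\mathcal{L}(X)\|_{\ell_2}^2\le(1+\delta')\|X\|_F^2$ for all $X\in\mathbb{R}^{q\times q}$ of rank at most $k$, and $\|\mathcal{L}\|_2$ denotes the operator norm of $\mathcal{L}$ with respect to the Frobenius norm on $\mathbb{R}^{q\times q}$ and the Euclidean norm on $\mathbb{R}^d$. Proposition. Fix $0<\delta<1$. There exist positive constants $c_1,c_2,c_3$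 depending only on $\delta$ such that the following holds for all integers $q,r\ge 1$ and $d\ge 0$ with $d\ge c_1\,q\,(r+\log q)$. Let $\tilde{\mathcal{L}}:\mathbb{R}^{q\times q}\to\mathbb{R}^d$ be the random linear map whose component matrices $\tilde{\mathcal{L}}_1,\dots,\tilde{\mathcal{L}}_d$ have i.i.d. Gaussian entries with mean zero and variance $1/d$. Then, with probability greater than $1-c_2\exp(-c_3d)$, there is a positive-definite rank-preserver $\mathcal{N}$ such that $\tilde{\mathcal{L}}\circ\mathcal{N}$ is normalized, and every normalized map $\mathcal{L}=\tilde{\mathcal{L}}\circ\mathcal{N}$ obtained by composing $\tilde{\mathcal{L}}$ with a positive-definite rank-preserver $\mathcal{N}$ satisfies (i) $\delta_{4r}(\mathcal{L})\le\delta$, and (ii) $\|\mathcal{L}\|_2\le\sqrt{5q^2/d}$ provided $d\le q^2$. -/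

import Mathlib

open MeasureTheory ProbabilityTheory
open scoped NNReal

namespace LowRankMap

/-- The operator norm of a linear map between normed spaces, with finite-dimensional domain. -/
noncomputable def linearMapNorm {V W : Type*} [NormedAddCommGroup V] [NormedSpace ℝ V]
    [FiniteDimensional ℝ V] [NormedAddCommGroup W] [NormedSpace ℝ W] (T : V →ₗ[ℝ] W) : ℝ :=
  ‖LinearMap.toContinuousLinearMap T‖

theorem norm_le_linearMapNorm {V W : Type*} [NormedAddCommGroup V] [NormedSpace ℝ V]
    [FiniteDimensional ℝ V] [NormedAddCommGroup W] [NormedSpace ℝ W] (T : V →ₗ[ℝ] W) (x : V) :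
    ‖T x‖ ≤ linearMapNorm T * ‖x‖ :=
  (LinearMap.toContinuousLinearMap T).le_opNorm x

section

open scoped Matrix.Norms.Frobenius

variable {q d : ℕ}

/-- Linear maps from `q × q` real matrices to Euclidean `d`-space. -/
abbrev MatrixMap (q d : ℕ) : Type :=
  Matrix (Fin q) (Fin q) ℝ →ₗ[ℝ] EuclideanSpace ℝ (Fin d)

/-- The linear map `X ↦ (⟨A i, X⟩)ᵢ` whose component linear functionals are given by the
matrices `A i`, through the trace inner product `⟨B, X⟩ = ∑ a b, B a b * X a b`. -/
noncomputable def ofComponents (A : Fin d → Matrix (Fin q) (Fin q) ℝ) : MatrixMap q d where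
  toFun X := WithLp.toLp 2 fun i => ∑ a, ∑ b, A i a b * X a b
  map_add' X Y := by
    ext i
    simp [mul_add, Finset.sum_add_distrib]
  map_smul' c X := by
    ext i
    simp [Finset.mul_sum, mul_left_comm]

/-- The matrix representing the `i`-th component linear functional of `L`. -/
noncomputable def component (L : MatrixMap q d) (i : Fin d) : Matrix (Fin q) (Fin q) ℝ :=
  Matrix.of fun a b => L (Matrix.single a b 1) i

theorem component_ofComponents (A : Fin d → Matrix (Fin q) (Fin q) ℝ) (i : Fin d) :
    component (ofComponents A) i = A i := by
  ext a b
  simp [component, ofComponents, Matrix.single_apply, ite_and]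

theorem ofComponents_component (L : MatrixMap q d) : ofComponents (component L) = L := by
  refine LinearMap.ext fun X => ?_
  ext i
  have h : X = ∑ a, ∑ b, X a b • Matrix.single a b (1 : ℝ) := by
    conv_lhs => rw [Matrix.matrix_eq_sum_single X]
    simp [Matrix.smul_single]
  conv_rhs => rw [h]
  simp only [map_sum, map_smul, PiLp.smul_apply, WithLp.ofLp_sum, Finset.sum_apply, smul_eq_mul]
  simp [ofComponents, component, mul_comm]

/-- `L` is normalized: `∑ Lᵢ Lᵢᵀ = q I` and `∑ Lᵢᵀ Lᵢ = q I`. -/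
def IsNormalized (L : MatrixMap q d) : Prop :=
  ∑ i, component L i * (component L i).transpose = (q : ℝ) • (1 : Matrix (Fin q) (Fin q) ℝ) ∧
  ∑ i, (component L i).transpose * component L i = (q : ℝ) • (1 : Matrix (Fin q) (Fin q) ℝ)

/-- Positive-definite rank-preservers: the maps `X ↦ P₁ X P₂` with `P₁`, `P₂` symmetric
positive definite. -/
def IsPosDefRankPreserver
    (N : Matrix (Fin q) (Fin q) ℝ →ₗ[ℝ] Matrix (Fin q) (Fin q) ℝ) : Prop :=
  ∃ P₁ P₂ : Matrix (Fin q) (Fin q) ℝ, P₁.PosDef ∧ P₂.PosDef ∧ ∀ X, N X = P₁ * X * P₂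

/-- `δ` bounds the distortion of squared norms (Frobenius to Euclidean) by `L` on matrices of
rank at most `k`. -/
def IsRestrictedIsometryBound (L : MatrixMap q d) (k : ℕ) (δ : ℝ) : Prop :=
  ∀ X : Matrix (Fin q) (Fin q) ℝ, X.rank ≤ k →
    (1 - δ) * ‖X‖ ^ 2 ≤ ‖L X‖ ^ 2 ∧ ‖L X‖ ^ 2 ≤ (1 + δ) * ‖X‖ ^ 2

/-- The restricted isometry constant of order `k`: the smallest restricted isometry bound. -/
noncomputable def ricConst (L : MatrixMap q d) (k : ℕ) : ℝ :=
  sInf {δ : ℝ | IsRestrictedIsometryBound L k δ}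

/-- The operator norm `‖L‖₂`, for the Frobenius norm on matrices and the Euclidean norm. -/
noncomputable def opNorm (L : MatrixMap q d) : ℝ :=
  linearMapNorm L

/-- The infimum defining the restricted isometry constant is a minimum. -/
theorem isLeast_ricConst (L : MatrixMap q d) {k : ℕ} (hq : 1 ≤ q) (hk : 1 ≤ k) :
    IsLeast {δ : ℝ | IsRestrictedIsometryBound L k δ} (ricConst L k) := by
  have hclosed : IsClosed {δ : ℝ | IsRestrictedIsometryBound L k δ} := by
    have h : ∀ X : Matrix (Fin q) (Fin q) ℝ, IsClosed {δ : ℝ |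
        (1 - δ) * ‖X‖ ^ 2 ≤ ‖L X‖ ^ 2 ∧ ‖L X‖ ^ 2 ≤ (1 + δ) * ‖X‖ ^ 2} := fun X =>
      IsClosed.and (isClosed_le (by fun_prop) (by fun_prop))
        (isClosed_le (by fun_prop) (by fun_prop))
    simp only [IsRestrictedIsometryBound, Set.ofPred_forall]
    exact isClosed_iInter fun X => isClosed_iInter fun _ => h X
  refine hclosed.isLeast_csInf ?_ ⟨0, ?_⟩
  · set M := linearMapNorm L
    refine ⟨1 + M ^ 2, fun X _ => ?_⟩
    have h : ‖L X‖ ≤ M * ‖X‖ := norm_le_linearMapNorm L X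
    have h2 : ‖L X‖ ^ 2 ≤ (M * ‖X‖) ^ 2 := by gcongr
    have h3 := sq_nonneg (M * ‖X‖)
    constructor <;> nlinarith [sq_nonneg ‖L X‖, sq_nonneg ‖X‖]
  · intro δ hδ
    let a : Fin q := ⟨0, hq⟩
    let X : Matrix (Fin q) (Fin q) ℝ := Matrix.vecMulVec (Pi.single a 1) (Pi.single a 1)
    have hX : X ≠ 0 := fun h => by
      have := congrFun (congrFun h a) a
      simp [X, Matrix.vecMulVec_apply] at this
    obtain ⟨h1, h2⟩ := hδ X ((Matrix.rank_vecMulVec_le _ _).trans hk)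
    have : 0 < ‖X‖ ^ 2 := by positivity
    nlinarith

end

end LowRankMap

/-! ### One-dimensional Gaussian integrals and their products -/

section GaussianIntegrals

open scoped ENNReal

/-! The proof separates probability from determinism. With high probability the Gaussian map is
nearly isometric on matrices of rank at most 4r, and for d ≤ q² its squared norm is at most 4.95
q²/d. On that event, every normalizing rank-preserver is itself nearly an isometry of the Frobenius
norm, so both properties survive normalization at a small cost in constants.

Near isometry on low rank: for fixed X, a Chernoff bound concentrates ‖L(X)‖² around ‖X‖². A matrix
of rank at most k is a product UV with U in an operator-norm ball and V in a Frobenius ball, each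
ball of dimension qk. A union bound over nets of both balls, followed by a bilinear approximation
argument (`bilinear_near_isometry_of_nets`), covers all such products once d exceeds a constant
times qk.

Operator norm: nets would lose too much in the constant. Instead, the exponential of the bilinear
form, compensated to have mean 1, is averaged over Gaussian test vectors. If the form is large at
one pair of unit vectors, this average is exponentially large, by comparison with Gaussians
recentred near that pair; Markov's inequality concludes (`gaussianArray_exists_bilin_ge`).

Normalization: let T(Q) = ∑ Aᵢ Q Aᵢᵀ. Near isometry on rank-one matrices says that T(Q) is close to
tr(Q) I for positive semidefinite Q. Hence det Q / det T(Q) attains its maximum at a positive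
definite Q, and stationarity there gives T*(T(Q)⁻¹) = Q⁻¹, from which the scaling is read off
(`exists_scaling`). Conversely, P₁ T(P₂²) P₁ = qI and its dual force P₁ and P₂ to be nearly scalar,
with the product of the scalars near 1 (`sumSq_scaling_bounds`). -/

theorem lintegral_exp_linear_sub_sq_gaussianReal {v : ℝ≥0} (hv : v ≠ 0) (c K : ℝ)
    (hK : 0 < 1 + 2 * K * v) :
    ∫⁻ u, ENNReal.ofReal (Real.exp (c * u - K * u ^ 2)) ∂(gaussianReal 0 v) =
      ENNReal.ofReal ((√(1 + 2 * K * v))⁻¹ * Real.exp (c ^ 2 * v / (2 * (1 + 2 * K * v)))) := by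
  set a : ℝ := 1 + 2 * K * v with ha
  have hv0 : (0 : ℝ) < v := by positivity
  let w : ℝ≥0 := v / ⟨a, hK.le⟩
  have hwr : (w : ℝ) = v / a := rfl
  have hw : w ≠ 0 := by
    intro h
    have : (w : ℝ) = 0 := by simp [h]
    rw [hwr] at this
    have : (v : ℝ) / a > 0 := by positivity
    linarith
  rw [gaussianReal_of_var_ne_zero _ hv, lintegral_withDensity_eq_lintegral_mul _
    (measurable_gaussianPDF 0 v) (by fun_prop)]
  -- Completing the square: the tilted density is a constant times the density of a Gaussian with
  -- mean cv/a and variance v/a.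
  have key : ∀ u : ℝ, (gaussianPDF 0 v * fun u => ENNReal.ofReal (Real.exp (c * u - K * u ^ 2))) u =
      ENNReal.ofReal ((√a)⁻¹ * Real.exp (c ^ 2 * v / (2 * a))) * gaussianPDF (c * v / a) w u := by
    intro u
    simp only [Pi.mul_apply, gaussianPDF]
    rw [← ENNReal.ofReal_mul (gaussianPDFReal_nonneg _ _ _), ← ENNReal.ofReal_mul (by positivity)]
    congr 1
    simp only [gaussianPDFReal, hwr]
    have h1 : √(2 * Real.pi * (v / a)) = √(2 * Real.pi * v) / √a := by
      rw [← Real.sqrt_div (by positivity)]; congr 1; ring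
    rw [h1, mul_assoc, ← Real.exp_add]
    have h2 : -(u - 0) ^ 2 / (2 * v) + (c * u - K * u ^ 2) =
        c ^ 2 * v / (2 * a) + -(u - c * v / a) ^ 2 / (2 * (v / a)) := by
      field_simp
      rw [ha]; ring
    rw [h2, Real.exp_add]
    field_simp
  simp_rw [key]
  rw [lintegral_const_mul _ (measurable_gaussianPDF _ _), lintegral_gaussianPDF_eq_one _ hw, mul_one]

theorem lintegral_pi_prod {ι : Type*} [Fintype ι] {E : ι → Type*} [∀ i, MeasurableSpace (E i)]
    (μ : ∀ i, Measure (E i)) [∀ i, IsProbabilityMeasure (μ i)] (f : ∀ i, E i → ℝ≥0∞)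
    (hf : ∀ i, Measurable (f i)) :
    ∫⁻ x, ∏ i, f i (x i) ∂(Measure.pi μ) = ∏ i, ∫⁻ y, f i y ∂(μ i) := by
  have h : iIndepFun (fun i (x : ∀ i, E i) => f i (x i)) (Measure.pi μ) :=
    iIndepFun_pi (X := f) fun i => (hf i).aemeasurable
  rw [lintegral_prod_eq_prod_lintegral_of_indepFun Finset.univ _ h
    fun i => (hf i).comp (measurable_pi_apply i)]
  refine Finset.prod_congr rfl fun i _ => ?_
  exact (measurePreserving_eval μ i).lintegral_comp (hf i)

theorem map_sum_mul_pi_gaussianReal {κ : Type*} [Fintype κ] (v : ℝ≥0) (x : κ → ℝ) :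
    (Measure.pi fun _ : κ => gaussianReal 0 v).map (fun g => ∑ k, x k * g k) =
      gaussianReal 0 (v * ∑ k, ‖x k‖₊ ^ 2) := by
  have hlaw : ∀ k, (Measure.pi fun _ : κ => gaussianReal 0 v).map (fun g => x k * g k) =
      gaussianReal 0 (‖x k‖₊ ^ 2 * v) := by
    intro k
    have := (gaussianReal_const_mul (P := Measure.pi fun _ : κ => gaussianReal 0 v)
      (X := fun g => g k) (μ := 0) (v := v)
      ⟨(measurable_pi_apply k).aemeasurable, (measurePreserving_eval _ k).map_eq⟩ (x k)).map_eq
    rw [this]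
    congr 1
    · simp
    · congr 1
      ext; simp
  have hind : iIndepFun (fun k (g : κ → ℝ) => x k * g k)
      (Measure.pi fun _ : κ => gaussianReal 0 v) :=
    iIndepFun_pi (X := fun k (y : ℝ) => x k * y) fun i => by fun_prop
  refine Measure.ext_of_charFun ?_
  have := hind.charFun_map_fun_sum_eq_prod
    fun k => ((measurable_pi_apply k).const_mul _).aemeasurable
  rw [this]
  ext t
  simp only [Finset.prod_apply, hlaw, charFun_gaussianReal]
  rw [← Complex.exp_sum]
  congr 1
  simp only [Complex.ofReal_zero, mul_zero, zero_mul, zero_sub]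
  push_cast
  rw [Finset.sum_neg_distrib, Finset.mul_sum, Finset.sum_mul, Finset.sum_div]
  congr 1
  refine Finset.sum_congr rfl fun k _ => ?_
  ring

/-- The rows are independent and each enters only through its pairing with `x`, which is a
one-dimensional Gaussian. -/
theorem lintegral_prod_sum_mul_pi_gaussianReal {ι κ : Type*} [Fintype ι] [Fintype κ] (v : ℝ≥0)
    (x : κ → ℝ) (f : ι → ℝ → ℝ≥0∞) (hf : ∀ i, Measurable (f i)) :
    ∫⁻ g, ∏ i, f i (∑ k, x k * g i k)
        ∂(Measure.pi fun _ : ι => Measure.pi fun _ : κ => gaussianReal 0 v) =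
      ∏ i, ∫⁻ y, f i y ∂(gaussianReal 0 (v * ∑ k, ‖x k‖₊ ^ 2)) := by
  rw [lintegral_pi_prod (fun _ : ι => Measure.pi fun _ : κ => gaussianReal 0 v)
    (fun i (g : κ → ℝ) => f i (∑ k, x k * g k)) fun i => (hf i).comp (by fun_prop)]
  refine Finset.prod_congr rfl fun i _ => ?_
  rw [← map_sum_mul_pi_gaussianReal, lintegral_map (hf i) (by fun_prop)]

end GaussianIntegrals

/-! ### Concentration of the image of a fixed unit vector -/

section GaussianArrays

open scoped ENNReal

/-- The law of an array of independent centred Gaussians with common variance `v`. -/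
noncomputable abbrev gaussianArray (ι κ : Type*) [Fintype ι] [Fintype κ] (v : ℝ≥0) :
    Measure (ι → κ → ℝ) :=
  Measure.pi fun _ => Measure.pi fun _ => gaussianReal 0 v

theorem sum_nnnorm_sq_coe {κ : Type*} [Fintype κ] (x : κ → ℝ) :
    ((∑ k, ‖x k‖₊ ^ 2 : ℝ≥0) : ℝ) = ∑ k, x k ^ 2 := by
  push_cast
  simp

theorem measure_le_exp_mul_lintegral_exp {Ω : Type*} [MeasurableSpace Ω] (μ : Measure Ω)
    {f : Ω → ℝ} (hf : Measurable f) (c : ℝ) :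
    μ {ω | c ≤ f ω} ≤
      ENNReal.ofReal (Real.exp (-c)) * ∫⁻ ω, ENNReal.ofReal (Real.exp (f ω)) ∂μ := by
  have h := mul_meas_ge_le_lintegral (μ := μ) (f := fun ω => ENNReal.ofReal (Real.exp (f ω)))
    (by fun_prop) (ENNReal.ofReal (Real.exp c))
  have hset : {ω | ENNReal.ofReal (Real.exp c) ≤ ENNReal.ofReal (Real.exp (f ω))} =
      {ω | c ≤ f ω} := by
    ext ω
    simp [ENNReal.ofReal_le_ofReal_iff (Real.exp_nonneg _)]
  rw [hset] at h
  calc μ {ω | c ≤ f ω}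
      = ENNReal.ofReal (Real.exp (-c)) * (ENNReal.ofReal (Real.exp c) * μ {ω | c ≤ f ω}) := by
        rw [← mul_assoc, ← ENNReal.ofReal_mul (Real.exp_nonneg _), ← Real.exp_add]
        simp
    _ ≤ _ := by gcongr

theorem lintegral_exp_sum_sq_gaussianArray {ι κ : Type*} [Fintype ι] [Fintype κ] {v : ℝ≥0}
    (hv : v ≠ 0) {x : κ → ℝ} (hx : ∑ k, x k ^ 2 = 1) {K : ℝ} (hK : 0 < 1 + 2 * K * v) :
    ∫⁻ g, ENNReal.ofReal (Real.exp (-K * ∑ i, (∑ k, x k * g i k) ^ 2)) ∂(gaussianArray ι κ v) =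
      ENNReal.ofReal ((√(1 + 2 * K * v))⁻¹ ^ Fintype.card ι) := by
  have hx' : (∑ k, ‖x k‖₊ ^ 2 : ℝ≥0) = 1 := by
    apply NNReal.coe_injective
    rw [sum_nnnorm_sq_coe, hx]; simp
  have h := lintegral_prod_sum_mul_pi_gaussianReal (ι := ι) v x
    (fun _ y => ENNReal.ofReal (Real.exp (0 * y - K * y ^ 2))) (fun _ => by fun_prop)
  rw [hx', mul_one] at h
  simp only [lintegral_exp_linear_sub_sq_gaussianReal hv 0 K hK] at h
  rw [Finset.prod_const, Finset.card_univ, ← ENNReal.ofReal_pow (by positivity)] at h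
  convert h using 2
  · ext g
    rw [← ENNReal.ofReal_prod_of_nonneg (fun _ _ => Real.exp_nonneg _), ← Real.exp_sum,
      Finset.mul_sum]
    simp
  · simp

/-- Chernoff's bound for both tails at once: the sign of `τ` selects the side. Each row contributes
(1 + 2τ)^(-1/2) to the exponential moment, and `hb` says that this beats the threshold by a factor
exp(-b) per row. -/
theorem gaussianArray_sum_sq_tail {ι κ : Type*} [Fintype ι] [Fintype κ] [Nonempty ι]
    {x : κ → ℝ} (hx : ∑ k, x k ^ 2 = 1) {τ c b : ℝ} (hτ : 0 < 1 + 2 * τ)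
    (hb : Real.exp (2 * (τ * c + b)) ≤ 1 + 2 * τ) :
    gaussianArray ι κ (1 / (Fintype.card ι : ℝ≥0))
        {g | -τ * c ≤ -τ * ∑ i, (∑ k, x k * g i k) ^ 2} ≤
      ENNReal.ofReal (Real.exp (-b * Fintype.card ι)) := by
  set d := Fintype.card ι with hd
  have hd0 : (0 : ℝ) < d := by exact_mod_cast Fintype.card_pos
  have hv : (1 / (d : ℝ≥0)) ≠ 0 := by
    have : (d : ℝ≥0) ≠ 0 := by exact_mod_cast hd0.ne'
    positivity
  have hKv : 2 * (τ * d) * ((1 / (d : ℝ≥0) : ℝ≥0) : ℝ) = 2 * τ := by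
    push_cast; field_simp
  have hset : {g : ι → κ → ℝ | -τ * c ≤ -τ * ∑ i, (∑ k, x k * g i k) ^ 2} =
      {g | -(τ * d) * c ≤ -(τ * d) * ∑ i, (∑ k, x k * g i k) ^ 2} := by
    ext g
    simp only [Set.mem_ofPred_eq]
    constructor <;> intro h <;> nlinarith
  rw [hset]
  refine (measure_le_exp_mul_lintegral_exp _ (by fun_prop) _).trans ?_
  rw [lintegral_exp_sum_sq_gaussianArray hv hx (by rw [hKv]; exact hτ), hKv,
    ← ENNReal.ofReal_mul (Real.exp_nonneg _)]
  apply ENNReal.ofReal_le_ofReal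
  have h1 : Real.exp (τ * c + b) ≤ √(1 + 2 * τ) := by
    apply Real.le_sqrt_of_sq_le
    rw [← Real.exp_nat_mul]; exact_mod_cast hb
  have h2 : (√(1 + 2 * τ))⁻¹ ≤ Real.exp (-(τ * c + b)) := by
    rw [Real.exp_neg]; gcongr
  calc Real.exp (-(-(τ * d) * c)) * (√(1 + 2 * τ))⁻¹ ^ d
      ≤ Real.exp (-(-(τ * d) * c)) * Real.exp (-(τ * c + b)) ^ d := by gcongr
    _ = Real.exp (-b * d) := by
        rw [← Real.exp_nat_mul, ← Real.exp_add]; congr 1; ring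

theorem exp_neg_sub_sq_le {y : ℝ} (hy0 : 0 ≤ y) (hy : y ≤ 1 / 2) :
    Real.exp (-(y + y ^ 2)) ≤ 1 - y := by
  rw [Real.exp_neg, inv_le_comm₀ (Real.exp_pos _) (by linarith)]
  refine le_trans ?_ (Real.quadratic_le_exp_of_nonneg (x := y + y ^ 2) (by positivity))
  rw [inv_le_iff_one_le_mul₀ (by linarith)]
  have h : 0 ≤ y ^ 2 * (1 - y - y ^ 2 - y ^ 3) := by
    have h2 : y ^ 2 ≤ 1 / 4 := by nlinarith
    have h3 : y ^ 3 ≤ 1 / 8 := by nlinarith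
    apply mul_nonneg (sq_nonneg _); linarith
  nlinarith [h]

theorem exp_sub_sq_le {y : ℝ} (hy0 : 0 ≤ y) : Real.exp (y - y ^ 2 / 2) ≤ 1 + y := by
  rw [← Real.le_log_iff_exp_le (by linarith)]
  refine le_trans ?_ (Real.le_log_one_add_of_nonneg hy0)
  rw [le_div_iff₀ (by linarith)]
  nlinarith [pow_nonneg hy0 3]

theorem gaussianArray_sum_sq_not_mem_Icc {ι κ : Type*} [Fintype ι] [Fintype κ] [Nonempty ι]
    {x : κ → ℝ} (hx : ∑ k, x k ^ 2 = 1) {ε : ℝ} (hε0 : 0 < ε) (hε1 : ε ≤ 1) :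
    gaussianArray ι κ (1 / (Fintype.card ι : ℝ≥0))
        {g | ∑ i, (∑ k, x k * g i k) ^ 2 ∉ Set.Icc (1 - ε) (1 + ε)} ≤
      ENNReal.ofReal (2 * Real.exp (-(ε ^ 2 / 8) * Fintype.card ι)) := by
  -- For the upper tail, 2(τc + b) = -(y + y²) with y = ε/2; for the lower tail, the exponent is ε -
  -- 3ε²/4. Both choices of `τ` are optimal to leading order in ε up to constants.
  have hup := gaussianArray_sum_sq_tail (ι := ι) hx (τ := -(ε / 4)) (c := 1 + ε) (b := ε ^ 2 / 8)
    (by linarith) (by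
      have := exp_neg_sub_sq_le (y := ε / 2) (by positivity) (by linarith)
      calc _ = Real.exp (-(ε / 2 + (ε / 2) ^ 2)) := by congr 1; ring
        _ ≤ 1 - ε / 2 := this
        _ = _ := by ring)
  have hlow := gaussianArray_sum_sq_tail (ι := ι) hx (τ := ε / 2) (c := 1 - ε) (b := ε ^ 2 / 8)
    (by linarith) (by
      have := exp_sub_sq_le (y := ε) (by positivity)
      calc _ ≤ Real.exp (ε - ε ^ 2 / 2) := Real.exp_le_exp.2 (by nlinarith [sq_nonneg ε])
        _ ≤ 1 + ε := this
        _ = _ := by ring)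
  rw [two_mul, ENNReal.ofReal_add (Real.exp_nonneg _) (Real.exp_nonneg _)]
  refine (measure_mono ?_).trans ((measure_union_le _ _).trans (add_le_add hup hlow))
  intro g hg
  simp only [Set.mem_Icc, not_and_or, not_le, Set.mem_ofPred_eq, Set.mem_union] at hg ⊢
  rcases hg with hg | hg
  · right; nlinarith
  · left; nlinarith

end GaussianArrays

/-! ### Largest value of a Gaussian bilinear form -/

section GaussianOperatorNorm

open scoped ENNReal

theorem lintegral_exp_mul_gaussianReal (v : ℝ≥0) (c : ℝ) :
    ∫⁻ y, ENNReal.ofReal (Real.exp (c * y)) ∂(gaussianReal 0 v) =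
      ENNReal.ofReal (Real.exp (c ^ 2 * v / 2)) := by
  rcases eq_or_ne v 0 with rfl | hv
  · rw [gaussianReal_zero_var, lintegral_dirac]; simp
  · simpa using lintegral_exp_linear_sub_sq_gaussianReal hv c 0 (by simp)

/-- This is the Gibbs variational lower bound with trial law N(aw, (1 - a²)v): mean of the exponent
minus relative entropy. Given the closed form of the integral, it reduces to the nonnegativity of a
square and log z ≤ z - 1. -/
theorem exp_le_lintegral_exp_linear_sub_sq_gaussianReal {v : ℝ≥0} (hv : v ≠ 0) {K : ℝ}
    (hK : 0 ≤ K) {a : ℝ} (ha : a ^ 2 < 1) (c w : ℝ) :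
    ENNReal.ofReal (Real.exp (a * (c * w) - K * (a ^ 2 * w ^ 2 + (1 - a ^ 2) * v) -
        a ^ 2 * w ^ 2 / (2 * v) + a ^ 2 / 2 + Real.log (1 - a ^ 2) / 2)) ≤
      ∫⁻ u, ENNReal.ofReal (Real.exp (c * u - K * u ^ 2)) ∂(gaussianReal 0 v) := by
  have hv0 : (0 : ℝ) < v := by positivity
  have hb : (0 : ℝ) < 1 + 2 * K * v := by positivity
  rw [lintegral_exp_linear_sub_sq_gaussianReal hv c K hb]
  apply ENNReal.ofReal_le_ofReal
  set b : ℝ := 1 + 2 * K * v with hbdef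
  have hsq : (√b)⁻¹ = Real.exp (-(Real.log b / 2)) := by
    rw [Real.exp_neg, Real.exp_half, Real.exp_log hb]
  rw [hsq, ← Real.exp_add, Real.exp_le_exp]
  have hlog : Real.log (b * (1 - a ^ 2)) ≤ b * (1 - a ^ 2) - 1 :=
    Real.log_le_sub_one_of_pos (mul_pos hb (by linarith))
  rw [Real.log_mul hb.ne' (by linarith)] at hlog
  have hsquare : 0 ≤ (c * v - a * w * b) ^ 2 / (2 * b * v) := by positivity
  have hexp : (c * v - a * w * b) ^ 2 / (2 * b * v) =
      c ^ 2 * v / (2 * b) - a * (c * w) + a ^ 2 * w ^ 2 / (2 * v) + K * (a ^ 2 * w ^ 2) := by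
    field_simp
    rw [hbdef]; ring
  rw [hexp] at hsquare
  have hb1 : b * (1 - a ^ 2) = 1 - a ^ 2 + 2 * (K * ((1 - a ^ 2) * v)) := by rw [hbdef]; ring
  rw [hb1] at hlog
  linarith

/-- Variance 1/n matches the unit length of `w`: the trial law has mean squared length exactly 1,
and the a² terms of the entropy cancel, leaving only the logarithm. -/
theorem exp_le_lintegral_exp_linear_sub_sq_pi {κ : Type*} [Fintype κ] [Nonempty κ] {K : ℝ}
    (hK : 0 ≤ K) {a : ℝ} (ha : a ^ 2 < 1) (c : κ → ℝ) {w : κ → ℝ} (hw : ∑ k, w k ^ 2 = 1) :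
    ENNReal.ofReal (Real.exp (a * ∑ k, c k * w k - K +
        Fintype.card κ * Real.log (1 - a ^ 2) / 2)) ≤
      ∫⁻ u, ENNReal.ofReal (Real.exp (∑ k, c k * u k - K * ∑ k, u k ^ 2))
        ∂(Measure.pi fun _ : κ => gaussianReal 0 (1 / (Fintype.card κ : ℝ≥0))) := by
  set n := Fintype.card κ with hn
  have hn0 : (0 : ℝ) < n := by exact_mod_cast Fintype.card_pos
  have hv : (1 / (n : ℝ≥0)) ≠ 0 := by
    have : (n : ℝ≥0) ≠ 0 := by exact_mod_cast hn0.ne'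
    positivity
  have h := lintegral_pi_prod (fun _ : κ => gaussianReal 0 (1 / (n : ℝ≥0)))
    (fun k u => ENNReal.ofReal (Real.exp (c k * u - K * u ^ 2))) (fun k => by fun_prop)
  have hfun : ∀ u : κ → ℝ, ∏ k, ENNReal.ofReal (Real.exp (c k * u k - K * u k ^ 2)) =
      ENNReal.ofReal (Real.exp (∑ k, c k * u k - K * ∑ k, u k ^ 2)) := fun u => by
    rw [← ENNReal.ofReal_prod_of_nonneg (fun _ _ => Real.exp_nonneg _), ← Real.exp_sum,
      Finset.sum_sub_distrib, Finset.mul_sum]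
  simp_rw [hfun] at h
  rw [h]
  refine le_trans (le_of_eq ?_) (Finset.prod_le_prod' fun k _ =>
    exp_le_lintegral_exp_linear_sub_sq_gaussianReal hv hK ha (c k) (w k))
  rw [← ENNReal.ofReal_prod_of_nonneg (fun _ _ => Real.exp_nonneg _), ← Real.exp_sum]
  congr 2
  simp only [Finset.sum_add_distrib, Finset.sum_sub_distrib, ← Finset.mul_sum, ← Finset.sum_div,
    Finset.sum_const, Finset.card_univ, ← hn, hw, nsmul_eq_mul]
  push_cast
  field_simp
  ring

/-- The quadratic term is exactly the log-moment of the bilinear form, so the compensated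
exponential has mean 1 for every pair of test vectors. -/
theorem lintegral_exp_bilin_gaussianArray {ι κ : Type*} [Fintype ι] [Fintype κ] (v : ℝ≥0)
    (β : ℝ) (x : κ → ℝ) (u : ι → ℝ) :
    ∫⁻ g, ENNReal.ofReal (Real.exp (∑ i, (β * ∑ k, x k * g i k) * u i -
        (β ^ 2 * v / 2 * ∑ k, x k ^ 2) * ∑ i, u i ^ 2)) ∂(gaussianArray ι κ v) = 1 := by
  set X := ∑ k, x k ^ 2 with hX
  have h := lintegral_prod_sum_mul_pi_gaussianReal (ι := ι) v x
    (fun i y => ENNReal.ofReal (Real.exp (-(β ^ 2 * v / 2 * X) * u i ^ 2)) *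
      ENNReal.ofReal (Real.exp ((β * u i) * y))) (fun _ => by fun_prop)
  have hone : ∀ i, ∫⁻ y, ENNReal.ofReal (Real.exp (-(β ^ 2 * v / 2 * X) * u i ^ 2)) *
      ENNReal.ofReal (Real.exp ((β * u i) * y)) ∂(gaussianReal 0 (v * ∑ k, ‖x k‖₊ ^ 2)) = 1 := by
    intro i
    rw [lintegral_const_mul _ (by fun_prop), lintegral_exp_mul_gaussianReal,
      ← ENNReal.ofReal_mul (Real.exp_nonneg _), ← Real.exp_add, NNReal.coe_mul,
      sum_nnnorm_sq_coe, ← hX]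
    rw [← ENNReal.ofReal_one, ← Real.exp_zero]
    congr 2; ring
  simp only [hone, Finset.prod_const_one] at h
  rw [← h]
  congr 1; ext g
  simp_rw [← ENNReal.ofReal_mul (Real.exp_nonneg _), ← Real.exp_add]
  rw [← ENNReal.ofReal_prod_of_nonneg (fun _ _ => Real.exp_nonneg _), ← Real.exp_sum,
    Finset.sum_add_distrib, ← Finset.mul_sum]
  congr 2
  rw [neg_mul, neg_add_eq_sub]
  congr 1
  exact Finset.sum_congr rfl fun i _ => by ring

/-- Tail bound for the largest value of the bilinear form of a Gaussian array on unit vectors. -/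
theorem gaussianArray_exists_bilin_ge {ι κ : Type*} [Fintype ι] [Fintype κ] [Nonempty ι]
    [Nonempty κ] {v : ℝ≥0} {β : ℝ} (hβ : 0 ≤ β) {a : ℝ} (ha : a ^ 2 < 1) (t : ℝ) :
    gaussianArray ι κ v {g | ∃ (w : ι → ℝ) (y : κ → ℝ), ∑ i, w i ^ 2 = 1 ∧ ∑ k, y k ^ 2 = 1 ∧
        t ≤ ∑ i, (∑ k, y k * g i k) * w i} ≤
      ENNReal.ofReal (Real.exp (-(a ^ 2 * β * t - β ^ 2 * v / 2 +
        (Fintype.card ι + Fintype.card κ) * Real.log (1 - a ^ 2) / 2))) := by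
  set πι := Measure.pi fun _ : ι => gaussianReal 0 (1 / (Fintype.card ι : ℝ≥0)) with hπι
  set πκ := Measure.pi fun _ : κ => gaussianReal 0 (1 / (Fintype.card κ : ℝ≥0)) with hπκ
  set μ := gaussianArray ι κ v with hμ
  let F : (ι → κ → ℝ) → (κ → ℝ) → (ι → ℝ) → ℝ≥0∞ := fun g x u =>
    ENNReal.ofReal (Real.exp (∑ i, (β * ∑ k, x k * g i k) * u i -
        (β ^ 2 * v / 2 * ∑ k, x k ^ 2) * ∑ i, u i ^ 2))
  have hF : Measurable fun p : (ι → κ → ℝ) × (κ → ℝ) × (ι → ℝ) => F p.1 p.2.1 p.2.2 := by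
    simp only [F]; fun_prop
  have hF' : Measurable fun p : ((ι → κ → ℝ) × (κ → ℝ)) × (ι → ℝ) => F p.1.1 p.1.2 p.2 := by
    simp only [F]; fun_prop
  let Z : (ι → κ → ℝ) → ℝ≥0∞ := fun g => ∫⁻ x, ∫⁻ u, F g x u ∂πι ∂πκ
  have hZ : ∫⁻ g, Z g ∂μ = 1 := by
    have h1 : ∫⁻ g, Z g ∂μ = ∫⁻ x, ∫⁻ g, ∫⁻ u, F g x u ∂πι ∂μ ∂πκ :=
      lintegral_lintegral_swap (hF'.lintegral_prod_right').aemeasurable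
    rw [h1]
    have h2 : ∀ x, ∫⁻ g, ∫⁻ u, F g x u ∂πι ∂μ = 1 := by
      intro x
      rw [lintegral_lintegral_swap (by simp only [F, Function.uncurry_def]; fun_prop)]
      simp only [F, hμ, lintegral_exp_bilin_gaussianArray]
      simp
    simp [h2]
  set c := a ^ 2 * β * t - β ^ 2 * v / 2 +
        (Fintype.card ι + Fintype.card κ) * Real.log (1 - a ^ 2) / 2 with hc
  have hsub : {g | ∃ (w : ι → ℝ) (y : κ → ℝ), ∑ i, w i ^ 2 = 1 ∧ ∑ k, y k ^ 2 = 1 ∧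
        t ≤ ∑ i, (∑ k, y k * g i k) * w i} ⊆ {g | ENNReal.ofReal (Real.exp c) ≤ Z g} := by
    rintro g ⟨w, y, hw, hy, ht⟩
    -- The lower bound is applied twice, each time gaining a factor `a`: to the inner integral for
    -- every `x`, keeping the dependence on `x` exact, and then to the outer one around `y`.
    have hin : ∀ x : κ → ℝ, ENNReal.ofReal (Real.exp (∑ k, (a * β * ∑ i, g i k * w i) * x k -
        β ^ 2 * v / 2 * ∑ k, x k ^ 2)) *
        ENNReal.ofReal (Real.exp (Fintype.card ι * Real.log (1 - a ^ 2) / 2)) ≤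
          ∫⁻ u, F g x u ∂πι := by
      intro x
      refine le_trans (le_of_eq ?_) (exp_le_lintegral_exp_linear_sub_sq_pi (κ := ι)
        (K := β ^ 2 * v / 2 * ∑ k, x k ^ 2) (by positivity) ha
        (fun i => β * ∑ k, x k * g i k) hw)
      rw [← ENNReal.ofReal_mul (Real.exp_nonneg _), ← Real.exp_add]
      congr 4
      simp only [Finset.mul_sum, Finset.sum_mul]
      rw [Finset.sum_comm]
      exact Finset.sum_congr rfl fun i _ => Finset.sum_congr rfl fun k _ => by ring
    have hout : ENNReal.ofReal (Real.exp (a * ∑ k, (a * β * ∑ i, g i k * w i) * y k -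
        β ^ 2 * v / 2 + Fintype.card κ * Real.log (1 - a ^ 2) / 2)) *
        ENNReal.ofReal (Real.exp (Fintype.card ι * Real.log (1 - a ^ 2) / 2)) ≤ Z g := by
      refine le_trans ?_ (lintegral_mono hin)
      rw [lintegral_mul_const _ (by fun_prop)]
      gcongr
      exact exp_le_lintegral_exp_linear_sub_sq_pi (κ := κ) (K := β ^ 2 * v / 2) (by positivity) ha
        (fun k => a * β * ∑ i, g i k * w i) hy
    refine le_trans ?_ hout
    rw [← ENNReal.ofReal_mul (Real.exp_nonneg _), ← Real.exp_add]
    apply ENNReal.ofReal_le_ofReal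
    rw [Real.exp_le_exp, hc]
    have hB : a * ∑ k, (a * β * ∑ i, g i k * w i) * y k =
        a ^ 2 * β * ∑ i, (∑ k, y k * g i k) * w i := by
      simp only [Finset.mul_sum, Finset.sum_mul]
      rw [Finset.sum_comm]
      exact Finset.sum_congr rfl fun i _ => Finset.sum_congr rfl fun k _ => by ring
    rw [hB]
    have : a ^ 2 * β * t ≤ a ^ 2 * β * ∑ i, (∑ k, y k * g i k) * w i := by gcongr
    linarith
  have hZm : Measurable Z := hF'.lintegral_prod_right'.lintegral_prod_right'
  have hmk := mul_meas_ge_le_lintegral (μ := μ) hZm (ENNReal.ofReal (Real.exp c))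
  rw [hZ] at hmk
  refine (measure_mono hsub).trans ?_
  rw [Real.exp_neg, ENNReal.ofReal_inv_of_pos (Real.exp_pos _)]
  exact ENNReal.le_inv_iff_mul_le.2 (by rwa [mul_comm])

end GaussianOperatorNorm

/-! ### Nets of unit balls and bilinear approximation -/

section Nets

open Module Metric Function
open scoped ENNReal

variable {E : Type*} [NormedAddCommGroup E] [NormedSpace ℝ E] [FiniteDimensional ℝ E]

/-- Volume comparison: the balls of radius ρ/2 around the points are disjoint and lie in the ball of
radius 1 + ρ/2. -/
theorem card_le_of_separated_unitBall {ρ : ℝ} (hρ : 0 < ρ) (s : Finset E)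
    (hs : ∀ c ∈ s, ‖c‖ ≤ 1) (h : ∀ c ∈ s, ∀ d ∈ s, c ≠ d → ρ ≤ ‖c - d‖) :
    (s.card : ℝ) ≤ (1 + 2 / ρ) ^ finrank ℝ E := by
  borelize E
  let μ : Measure E := Measure.addHaar
  have hδ : 0 < ρ / 2 := by positivity
  have hR : 0 < 1 + ρ / 2 := by positivity
  have hdisj : Set.Pairwise (s : Set E) (Disjoint on fun c => ball (c : E) (ρ / 2)) := by
    rintro c hc d hd hcd
    apply ball_disjoint_ball
    rw [dist_eq_norm]
    linarith [h c hc d hd hcd]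
  have hsub : (⋃ c ∈ s, ball (c : E) (ρ / 2)) ⊆ ball (0 : E) (1 + ρ / 2) := by
    refine Set.iUnion₂_subset fun x hx => ball_subset_ball' ?_
    rw [dist_zero_right]
    linarith [hs x hx]
  have I : (s.card : ℝ≥0∞) * ENNReal.ofReal ((ρ / 2) ^ finrank ℝ E) * μ (ball 0 1) ≤
      ENNReal.ofReal ((1 + ρ / 2) ^ finrank ℝ E) * μ (ball 0 1) :=
    calc (s.card : ℝ≥0∞) * ENNReal.ofReal ((ρ / 2) ^ finrank ℝ E) * μ (ball 0 1)
        = μ (⋃ c ∈ s, ball (c : E) (ρ / 2)) := by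
          rw [measure_biUnion_finset hdisj fun c _ => measurableSet_ball]
          simp only [μ.addHaar_ball_of_pos _ hδ, Finset.sum_const, nsmul_eq_mul, mul_assoc]
      _ ≤ μ (ball (0 : E) (1 + ρ / 2)) := measure_mono hsub
      _ = _ := by simp only [μ.addHaar_ball_of_pos _ hR]
  have J := (ENNReal.mul_le_mul_iff_left (measure_ball_pos _ _ zero_lt_one).ne'
    measure_ball_lt_top.ne).1 I
  have K := ENNReal.toReal_le_of_le_ofReal (by positivity) J
  rw [ENNReal.toReal_mul, ENNReal.toReal_natCast, ENNReal.toReal_ofReal (by positivity)] at K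
  have hfrac : 1 + 2 / ρ = (1 + ρ / 2) / (ρ / 2) := by field_simp; ring
  rw [hfrac, div_pow, le_div_iff₀ (by positivity)]
  exact K

/-- The unit ball of a finite-dimensional space has a `ρ`-net of cardinality at most
`(1 + 2 / ρ) ^ dim`. -/
theorem exists_finset_net_unitBall (E : Type*) [NormedAddCommGroup E] [NormedSpace ℝ E]
    [FiniteDimensional ℝ E] {ρ : ℝ} (hρ : 0 < ρ) :
    ∃ s : Finset E, (∀ c ∈ s, ‖c‖ ≤ 1) ∧ (∀ x : E, ‖x‖ ≤ 1 → ∃ c ∈ s, ‖x - c‖ ≤ ρ) ∧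
      (s.card : ℝ) ≤ (1 + 2 / ρ) ^ finrank ℝ E := by
  classical
  let p : ℕ → Prop := fun n => ∃ s : Finset E, s.card = n ∧ (∀ c ∈ s, ‖c‖ ≤ 1) ∧
    ∀ c ∈ s, ∀ d ∈ s, c ≠ d → ρ ≤ ‖c - d‖
  have hp0 : p 0 := ⟨∅, by simp, by simp, by simp⟩
  set N := ⌊(1 + 2 / ρ) ^ finrank ℝ E⌋₊
  have hbound : ∀ n, p n → n ≤ N := by
    rintro n ⟨s, rfl, hs1, hs2⟩
    exact Nat.le_floor (card_le_of_separated_unitBall hρ s hs1 hs2)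
  -- A separated set of maximal cardinality is a net, since a point far from all of it could be
  -- added.
  obtain ⟨s, hcard, hs1, hs2⟩ := Nat.findGreatest_spec (P := p) (Nat.zero_le N) hp0
  refine ⟨s, hs1, fun x hx => ?_, card_le_of_separated_unitBall hρ s hs1 hs2⟩
  by_contra! hfar
  have hxs : x ∉ s := fun hxs => by
    have := hfar x hxs
    simp at this; linarith
  have hp : p (s.card + 1) := by
    refine ⟨insert x s, by simp [hxs], ?_, ?_⟩
    · simpa using ⟨hx, hs1⟩
    · intro c hc d hd hcd
      rw [Finset.mem_insert] at hc hd
      rcases hc with rfl | hc <;> rcases hd with rfl | hd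
      · exact absurd rfl hcd
      · exact (hfar d hd).le
      · rw [norm_sub_rev]; exact (hfar c hc).le
      · exact hs2 c hc d hd hcd
  have := Nat.le_findGreatest (hbound _ hp) hp
  omega

theorem bilinear_sub_le {E F K : Type*}
    [NormedAddCommGroup E] [NormedSpace ℝ E] [NormedAddCommGroup F] [NormedSpace ℝ F]
    [NormedAddCommGroup K] [NormedSpace ℝ K] (T : E →L[ℝ] F →L[ℝ] K) {C ρ : ℝ} (hC : 0 ≤ C)
    (hT : ∀ U V, ‖T U V‖ ≤ C * ‖U‖ * ‖V‖) {U U' : E} {V V' : F} (hV : ‖V‖ ≤ 1) (hU' : ‖U'‖ ≤ 1)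
    (h1 : ‖U - U'‖ ≤ ρ) (h2 : ‖V - V'‖ ≤ ρ) : ‖T U V - T U' V'‖ ≤ C * (2 * ρ) := by
  have heq : T U V - T U' V' = T (U - U') V + T U' (V - V') := by
    simp
  rw [heq]
  refine (norm_add_le _ _).trans ?_
  have hρ : 0 ≤ ρ := (norm_nonneg _).trans h1
  have e1 := hT (U - U') V
  have e2 := hT U' (V - V')
  have e3 : C * ‖U - U'‖ * ‖V‖ ≤ C * ρ * 1 := by gcongr
  have e4 : C * ‖U'‖ * ‖V - V'‖ ≤ C * 1 * ρ := by gcongr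
  linarith

/-- Near-isometry of a bilinear map relative to another one extends from nets to unit balls. -/
theorem bilinear_near_isometry_of_nets {E F G H : Type*}
    [NormedAddCommGroup E] [NormedSpace ℝ E] [NormedAddCommGroup F] [NormedSpace ℝ F]
    [NormedAddCommGroup G] [NormedSpace ℝ G] [NormedAddCommGroup H] [NormedSpace ℝ H]
    (B : E →L[ℝ] F →L[ℝ] G) (m : E →L[ℝ] F →L[ℝ] H) (hm : ∀ U V, ‖m U V‖ ≤ ‖U‖ * ‖V‖)
    {ε : ℝ} (hε0 : 0 < ε) (hε1 : ε ≤ 1 / 4) {s : Set E} {t : Set F}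
    (hs1 : ∀ c ∈ s, ‖c‖ ≤ 1) (ht1 : ∀ c ∈ t, ‖c‖ ≤ 1)
    (hs : ∀ x : E, ‖x‖ ≤ 1 → ∃ c ∈ s, ‖x - c‖ ≤ ε / 8)
    (ht : ∀ x : F, ‖x‖ ≤ 1 → ∃ c ∈ t, ‖x - c‖ ≤ ε / 8)
    (h : ∀ U ∈ s, ∀ V ∈ t, (1 - ε) * ‖m U V‖ ≤ ‖B U V‖ ∧ ‖B U V‖ ≤ (1 + ε) * ‖m U V‖)
    {U : E} {V : F} (hU : ‖U‖ ≤ 1) (hV : ‖V‖ ≤ 1) (hUV : ‖m U V‖ = 1) :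
    1 - 2 * ε ≤ ‖B U V‖ ∧ ‖B U V‖ ≤ 1 + 2 * ε := by
  have hBn : ∀ U V, ‖B U V‖ ≤ ‖B‖ * ‖U‖ * ‖V‖ := fun U V => B.le_opNorm₂ U V
  -- Passing to the nets costs ‖B‖ε/4, so taking the supremum bounds ‖B‖ in terms of itself with a
  -- small coefficient, which is then absorbed.
  have hup : ∀ U V, ‖U‖ ≤ 1 → ‖V‖ ≤ 1 → ‖B U V‖ ≤ (1 + ε) + ‖B‖ * (ε / 4) := by
    intro U V hU hV
    obtain ⟨U', hU's, hU'⟩ := hs U hU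
    obtain ⟨V', hV't, hV'⟩ := ht V hV
    have h1 := bilinear_sub_le B (by positivity) hBn hV (hs1 _ hU's) hU' hV'
    have h2 := (h U' hU's V' hV't).2
    have h3 : ‖m U' V'‖ ≤ 1 := (hm U' V').trans
      (mul_le_one₀ (hs1 _ hU's) (norm_nonneg _) (ht1 _ hV't))
    have h4 := norm_sub_norm_le (B U V) (B U' V')
    nlinarith
  have hM : ‖B‖ ≤ (1 + ε) + ‖B‖ * (ε / 4) := by
    have hnn : 0 ≤ (1 + ε) + ‖B‖ * (ε / 4) := by positivity
    refine ContinuousLinearMap.opNorm_le_of_unit_norm hnn fun x hx => ?_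
    exact ContinuousLinearMap.opNorm_le_of_unit_norm hnn fun y hy => hup x y hx.le hy.le
  have hM2 : ‖B‖ ≤ 1 + 2 * ε := by
    by_contra! hcon
    nlinarith
  refine ⟨?_, ?_⟩
  · obtain ⟨U', hU's, hU'⟩ := hs U hU
    obtain ⟨V', hV't, hV'⟩ := ht V hV
    have h1 := bilinear_sub_le B (by positivity) hBn hV (hs1 _ hU's) hU' hV'
    have h2 := (h U' hU's V' hV't).1
    have h3 := bilinear_sub_le m zero_le_one (by simpa using hm) hV (hs1 _ hU's) hU' hV'
    have h4 : 1 - ε / 4 ≤ ‖m U' V'‖ := by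
      have := norm_sub_norm_le (m U V) (m U' V')
      linarith
    have h5 : ‖B U' V'‖ - ‖B U V‖ ≤ ‖B U V - B U' V'‖ := by
      rw [norm_sub_rev]; exact norm_sub_norm_le _ _
    nlinarith
  · calc ‖B U V‖ ≤ ‖B‖ * ‖U‖ * ‖V‖ := hBn U V
      _ ≤ ‖B‖ * 1 * 1 := by gcongr
      _ ≤ _ := by linarith

end Nets

/-! ### Factorization of low-rank matrices -/

namespace LowRankMap

section Factorization

open scoped Matrix.Norms.Frobenius

variable {q k d : ℕ}

theorem frobenius_norm_sq (X : Matrix (Fin q) (Fin q) ℝ) : ‖X‖ ^ 2 = ∑ a, ∑ b, X a b ^ 2 := by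
  rw [Matrix.frobenius_norm_def, ← Real.sqrt_eq_rpow, Real.sq_sqrt (by positivity)]
  simp

/-- The product `U V`, with `U` viewed as an operator, `V` as a tuple of columns and the product
as its family of entries, as a continuous bilinear map. -/
noncomputable def factorProd (q k : ℕ) :
    (EuclideanSpace ℝ (Fin k) →L[ℝ] EuclideanSpace ℝ (Fin q)) →L[ℝ]
      (PiLp 2 fun _ : Fin q => EuclideanSpace ℝ (Fin k)) →L[ℝ]
        EuclideanSpace ℝ (Fin q × Fin q) :=
  LinearMap.mkContinuous₂
    (LinearMap.mk₂ ℝ (fun U V => WithLp.toLp 2 fun p => U (V p.2) p.1)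
      (fun _ _ _ => by ext; simp) (fun _ _ _ => by ext; simp)
      (fun _ _ _ => by ext; simp) (fun _ _ _ => by ext; simp)) 1 (by
      intro U V
      rw [one_mul]
      refine le_of_sq_le_sq ?_ (by positivity)
      rw [EuclideanSpace.norm_sq_eq, mul_pow, PiLp.norm_sq_eq_of_L2 _ V, Finset.mul_sum,
        Fintype.sum_prod_type, Finset.sum_comm]
      refine Finset.sum_le_sum fun b _ => ?_
      have h2 := U.le_opNorm (V b)
      calc _ = ‖U (V b)‖ ^ 2 := by rw [EuclideanSpace.norm_sq_eq]; simp
        _ ≤ (‖U‖ * ‖V b‖) ^ 2 := by gcongr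
        _ = _ := by ring)

theorem factorProd_apply (U : EuclideanSpace ℝ (Fin k) →L[ℝ] EuclideanSpace ℝ (Fin q))
    (V : PiLp 2 fun _ : Fin q => EuclideanSpace ℝ (Fin k)) (p : Fin q × Fin q) :
    factorProd q k U V p = U (V p.2) p.1 := rfl

theorem norm_factorProd_le (U : EuclideanSpace ℝ (Fin k) →L[ℝ] EuclideanSpace ℝ (Fin q))
    (V : PiLp 2 fun _ : Fin q => EuclideanSpace ℝ (Fin k)) :
    ‖factorProd q k U V‖ ≤ ‖U‖ * ‖V‖ := by
  have h := (factorProd q k).le_opNorm₂ U V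
  have h1 : ‖factorProd q k‖ ≤ 1 := LinearMap.mkContinuous₂_norm_le _ zero_le_one _
  calc _ ≤ ‖factorProd q k‖ * ‖U‖ * ‖V‖ := h
    _ ≤ 1 * ‖U‖ * ‖V‖ := by gcongr
    _ = _ := by ring

theorem exists_linearIsometry_euclideanSpace {W : Type*} [NormedAddCommGroup W]
    [InnerProductSpace ℝ W] [FiniteDimensional ℝ W] (h : Module.finrank ℝ W ≤ k) :
    Nonempty (W →ₗᵢ[ℝ] EuclideanSpace ℝ (Fin k)) := by
  let b := stdOrthonormalBasis ℝ W
  let f : W →ₗ[ℝ] EuclideanSpace ℝ (Fin k) :=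
    b.toBasis.constr ℝ fun i => EuclideanSpace.basisFun (Fin k) ℝ (Fin.castLE h i)
  refine ⟨f.isometryOfOrthonormal (v := b.toBasis) (by simp) ?_⟩
  have : f ∘ b.toBasis = EuclideanSpace.basisFun (Fin k) ℝ ∘ Fin.castLE h := by
    ext1 i
    simp only [Function.comp_apply, f, Module.Basis.constr_basis]
  rw [this]
  exact (EuclideanSpace.basisFun (Fin k) ℝ).orthonormal.comp _ (Fin.castLE_injective h)

/-- Embed the column space of `X` isometrically into k-space by φ. Then `V` collects the images
under φ of the columns, and `U` is the adjoint of φ, which undoes φ on its range. -/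
theorem exists_factorProd_eq {X : Matrix (Fin q) (Fin q) ℝ} (hX : X.rank ≤ k) :
    ∃ U V, ‖U‖ ≤ 1 ∧ ‖V‖ ≤ ‖X‖ ∧ ∀ a b, factorProd q k U V (a, b) = X a b := by
  let T := Matrix.toEuclideanLin X
  let W := LinearMap.range T
  have hW : Module.finrank ℝ W ≤ k := by
    rw [Matrix.rank_eq_finrank_range_toLin X (EuclideanSpace.basisFun (Fin q) ℝ).toBasis
      (EuclideanSpace.basisFun (Fin q) ℝ).toBasis] at hX
    exact hX
  obtain ⟨φ⟩ := exists_linearIsometry_euclideanSpace hW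
  let e : Fin q → W := fun b => ⟨T (EuclideanSpace.single b 1), LinearMap.mem_range_self _ _⟩
  have he : ∀ a b, ((e b : EuclideanSpace ℝ (Fin q))) a = X a b := by
    intro a b
    simp [e, T]
  refine ⟨W.subtypeL ∘L ContinuousLinearMap.adjoint φ.toContinuousLinearMap,
    WithLp.toLp 2 fun b => φ (e b), ?_, ?_, ?_⟩
  · refine (ContinuousLinearMap.opNorm_comp_le _ _).trans (mul_le_one₀ ?_ (by positivity) ?_)
    · exact Submodule.norm_subtypeL_le W
    · rw [LinearIsometryEquiv.norm_map]
      exact φ.norm_toContinuousLinearMap_le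
  · refine le_of_sq_le_sq ?_ (norm_nonneg _)
    rw [frobenius_norm_sq, PiLp.norm_sq_eq_of_L2, Finset.sum_comm]
    refine Finset.sum_le_sum fun b _ => ?_
    simp only [φ.norm_map]
    rw [Submodule.coe_norm, EuclideanSpace.norm_sq_eq]
    simp [he]
  · intro a b
    rw [factorProd_apply, ← he a b]
    have : ContinuousLinearMap.adjoint φ.toContinuousLinearMap (φ (e b)) = e b := by
      refine ext_inner_left ℝ fun z => ?_
      rw [ContinuousLinearMap.adjoint_inner_right]
      exact φ.inner_map_map z (e b)
    simp [this]

end Factorization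

end LowRankMap

/-! ### Restricted isometry and operator norm of Gaussian maps -/

namespace LowRankMap

section GaussianMaps

open scoped Matrix.Norms.Frobenius ENNReal

variable {q k d : ℕ}

/-- The map whose component matrices are the rows of an array. -/
noncomputable def arrayMap (g : Fin d → Fin q × Fin q → ℝ) : MatrixMap q d :=
  ofComponents fun i => Matrix.of fun a b => g i (a, b)

theorem arrayMap_apply (g : Fin d → Fin q × Fin q → ℝ) (X : Matrix (Fin q) (Fin q) ℝ)
    (i : Fin d) : arrayMap g X i = ∑ p : Fin q × Fin q, X p.1 p.2 * g i p := by
  simp [arrayMap, ofComponents, Fintype.sum_prod_type, mul_comm]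

theorem norm_sq_arrayMap (g : Fin d → Fin q × Fin q → ℝ) (X : Matrix (Fin q) (Fin q) ℝ) :
    ‖arrayMap g X‖ ^ 2 = ∑ i, (∑ p : Fin q × Fin q, X p.1 p.2 * g i p) ^ 2 := by
  simp [EuclideanSpace.norm_sq_eq, arrayMap_apply]

theorem frobenius_norm_sq_eq_sum_prod (X : Matrix (Fin q) (Fin q) ℝ) :
    ‖X‖ ^ 2 = ∑ p : Fin q × Fin q, X p.1 p.2 ^ 2 := by
  rw [frobenius_norm_sq, Fintype.sum_prod_type]

/-- The linear map with matrix `g`, from Euclidean space. -/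
noncomputable def arrayCLM (g : Fin d → Fin q × Fin q → ℝ) :
    EuclideanSpace ℝ (Fin q × Fin q) →L[ℝ] EuclideanSpace ℝ (Fin d) :=
  LinearMap.toContinuousLinearMap (Matrix.toEuclideanLin (Matrix.of g))

theorem arrayCLM_apply (g : Fin d → Fin q × Fin q → ℝ) (x : EuclideanSpace ℝ (Fin q × Fin q))
    (i : Fin d) : arrayCLM g x i = ∑ p, x p * g i p := by
  simp [arrayCLM, Matrix.toLpLin_apply, Matrix.mulVec, dotProduct, mul_comm]

theorem norm_sq_arrayCLM (g : Fin d → Fin q × Fin q → ℝ) (x : EuclideanSpace ℝ (Fin q × Fin q)) :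
    ‖arrayCLM g x‖ ^ 2 = ∑ i, (∑ p, x p * g i p) ^ 2 := by
  simp [EuclideanSpace.norm_sq_eq, arrayCLM_apply]

theorem measure_norm_sq_arrayCLM_not_mem_Icc (hd : 1 ≤ d) {ε : ℝ} (hε0 : 0 < ε) (hε1 : ε ≤ 1)
    (x : EuclideanSpace ℝ (Fin q × Fin q)) :
    gaussianArray (Fin d) (Fin q × Fin q) (1 / (d : ℝ≥0))
        {g | ‖arrayCLM g x‖ ^ 2 ∉ Set.Icc ((1 - ε) * ‖x‖ ^ 2) ((1 + ε) * ‖x‖ ^ 2)} ≤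
      ENNReal.ofReal (2 * Real.exp (-(ε ^ 2 / 8) * d)) := by
  rcases eq_or_ne x 0 with rfl | hx
  · simp
  have hx0 : 0 < ‖x‖ := norm_pos_iff.2 hx
  have : Nonempty (Fin d) := ⟨⟨0, hd⟩⟩
  have hunit : ∑ p, (‖x‖⁻¹ * x p) ^ 2 = 1 := by
    have := EuclideanSpace.norm_sq_eq x
    simp only [Real.norm_eq_abs, sq_abs] at this
    simp_rw [mul_pow]
    rw [← Finset.mul_sum, ← this]
    field_simp
  have h := gaussianArray_sum_sq_not_mem_Icc (ι := Fin d) hunit hε0 hε1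
  rw [Fintype.card_fin] at h
  refine le_trans (measure_mono ?_) h
  intro g hg
  simp only [Set.mem_ofPred_eq, norm_sq_arrayCLM] at hg ⊢
  refine fun hmem => hg ?_
  have hs : ∑ i, (∑ p, ‖x‖⁻¹ * x p * g i p) ^ 2 = (‖x‖ ^ 2)⁻¹ * ∑ i, (∑ p, x p * g i p) ^ 2 := by
    simp_rw [mul_assoc, ← Finset.mul_sum, mul_pow]
    rw [← Finset.mul_sum, inv_pow]
  rw [hs, Set.mem_Icc] at hmem
  have hsq : 0 < ‖x‖ ^ 2 := by positivity
  rw [inv_mul_eq_div, le_div_iff₀ hsq, div_le_iff₀ hsq] at hmem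
  exact hmem

/-- Working with factors makes the parameter set a product of balls, on which approximation is
bilinear; the set of low-rank matrices itself is not closed under differences. The factor 5 comes
from (1 + 2ε)² ≤ 1 + 5ε for ε ≤ 1/4. -/
theorem isRestrictedIsometryBound_of_nets {ε : ℝ} (hε0 : 0 < ε) (hε1 : ε ≤ 1 / 4)
    {s : Set (EuclideanSpace ℝ (Fin k) →L[ℝ] EuclideanSpace ℝ (Fin q))}
    {t : Set (PiLp 2 fun _ : Fin q => EuclideanSpace ℝ (Fin k))}
    (hs1 : ∀ c ∈ s, ‖c‖ ≤ 1) (ht1 : ∀ c ∈ t, ‖c‖ ≤ 1)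
    (hs : ∀ x, ‖x‖ ≤ 1 → ∃ c ∈ s, ‖x - c‖ ≤ ε / 8)
    (ht : ∀ x, ‖x‖ ≤ 1 → ∃ c ∈ t, ‖x - c‖ ≤ ε / 8) (g : Fin d → Fin q × Fin q → ℝ)
    (h : ∀ U ∈ s, ∀ V ∈ t, ‖arrayCLM g (factorProd q k U V)‖ ^ 2 ∈
      Set.Icc ((1 - ε) * ‖factorProd q k U V‖ ^ 2) ((1 + ε) * ‖factorProd q k U V‖ ^ 2)) :
    IsRestrictedIsometryBound (arrayMap g) k (5 * ε) := by
  let B := ((ContinuousLinearMap.compL ℝ (PiLp 2 fun _ : Fin q => EuclideanSpace ℝ (Fin k))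
    (EuclideanSpace ℝ (Fin q × Fin q)) (EuclideanSpace ℝ (Fin d))) (arrayCLM g)).comp
      (factorProd q k)
  have hB : ∀ U V, B U V = arrayCLM g (factorProd q k U V) := fun _ _ => rfl
  have hunit : ∀ X : Matrix (Fin q) (Fin q) ℝ, X.rank ≤ k → ‖X‖ = 1 →
      1 - 2 * ε ≤ ‖arrayMap g X‖ ∧ ‖arrayMap g X‖ ≤ 1 + 2 * ε := by
    intro X hX hX1
    obtain ⟨U, V, hU, hV, hUV⟩ := exists_factorProd_eq hX
    have hnorm : ‖factorProd q k U V‖ = 1 := by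
      refine Eq.trans ?_ hX1
      rw [← sq_eq_sq₀ (norm_nonneg _) (norm_nonneg _),
        EuclideanSpace.norm_sq_eq, frobenius_norm_sq_eq_sum_prod]
      simp [hUV]
    have hmap : ‖arrayMap g X‖ = ‖B U V‖ := by
      rw [hB, ← sq_eq_sq₀ (norm_nonneg _) (norm_nonneg _), norm_sq_arrayMap, norm_sq_arrayCLM]
      simp [hUV]
    rw [hmap]
    refine bilinear_near_isometry_of_nets B (factorProd q k) norm_factorProd_le hε0 hε1
      hs1 ht1 hs ht (fun U hU V hV => ?_) hU (hV.trans hX1.le) hnorm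
    obtain ⟨h1, h2⟩ := h U hU V hV
    rw [← hB] at h1 h2
    constructor
    · refine le_of_sq_le_sq (le_trans ?_ h1) (norm_nonneg _)
      rw [mul_pow]
      gcongr
      nlinarith
    · refine le_of_sq_le_sq (h2.trans ?_) (by positivity)
      rw [mul_pow]
      gcongr
      nlinarith
  intro X hX
  rcases eq_or_ne X 0 with rfl | hX0
  · simp
  have hpos : 0 < ‖X‖ := norm_pos_iff.2 hX0
  obtain ⟨h1, h2⟩ := hunit (‖X‖⁻¹ • X) (by
      rw [← one_mul X, ← smul_mul_assoc]
      exact (Matrix.rank_mul_le_right _ _).trans hX)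
    (by rw [norm_smul, norm_inv, norm_norm, inv_mul_cancel₀ hpos.ne'])
  rw [map_smul, norm_smul, norm_inv, norm_norm, inv_mul_eq_div] at h1 h2
  rw [le_div_iff₀ hpos] at h1
  rw [div_le_iff₀ hpos] at h2
  have e1 : ((1 - 2 * ε) * ‖X‖) ^ 2 ≤ ‖arrayMap g X‖ ^ 2 := by
    have : 0 ≤ 1 - 2 * ε := by linarith
    gcongr
  have e2 : ‖arrayMap g X‖ ^ 2 ≤ ((1 + 2 * ε) * ‖X‖) ^ 2 := by gcongr
  have hsq : 0 ≤ ‖X‖ ^ 2 := sq_nonneg _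
  constructor
  · refine le_trans ?_ e1
    rw [mul_pow]
    gcongr
    nlinarith
  · refine e2.trans ?_
    rw [mul_pow]
    gcongr
    nlinarith

theorem finrank_continuousLinearMap_euclideanSpace :
    Module.finrank ℝ (EuclideanSpace ℝ (Fin k) →L[ℝ] EuclideanSpace ℝ (Fin q)) = q * k := by
  rw [← (LinearMap.toContinuousLinearMap (𝕜 := ℝ) (E := EuclideanSpace ℝ (Fin k))
    (F' := EuclideanSpace ℝ (Fin q))).finrank_eq, Module.finrank_linearMap]
  simp [mul_comm]

theorem finrank_piLp_euclideanSpace :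
    Module.finrank ℝ (PiLp 2 fun _ : Fin q => EuclideanSpace ℝ (Fin k)) = q * k := by
  rw [(WithLp.linearEquiv 2 ℝ (Fin q → EuclideanSpace ℝ (Fin k))).finrank_eq,
    Module.finrank_pi_fintype]
  simp

/-- Gaussian maps satisfy the restricted isometry property with overwhelming probability. -/
theorem measure_not_isRestrictedIsometryBound_le (hd : 1 ≤ d) {ε : ℝ} (hε0 : 0 < ε)
    (hε1 : ε ≤ 1 / 4) (hk : 2 * (q * k : ℕ) * Real.log (1 + 16 / ε) ≤ ε ^ 2 / 16 * d) :
    gaussianArray (Fin d) (Fin q × Fin q) (1 / (d : ℝ≥0))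
        {g | ¬ IsRestrictedIsometryBound (arrayMap g) k (5 * ε)} ≤
      ENNReal.ofReal (2 * Real.exp (-(ε ^ 2 / 16) * d)) := by
  obtain ⟨s, hs1, hs, hsc⟩ := exists_finset_net_unitBall
    (EuclideanSpace ℝ (Fin k) →L[ℝ] EuclideanSpace ℝ (Fin q)) (ρ := ε / 8) (by positivity)
  obtain ⟨t, ht1, ht, htc⟩ := exists_finset_net_unitBall
    (PiLp 2 fun _ : Fin q => EuclideanSpace ℝ (Fin k)) (ρ := ε / 8) (by positivity)
  rw [finrank_continuousLinearMap_euclideanSpace] at hsc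
  rw [finrank_piLp_euclideanSpace] at htc
  set μ := gaussianArray (Fin d) (Fin q × Fin q) (1 / (d : ℝ≥0))
  let bad : (EuclideanSpace ℝ (Fin k) →L[ℝ] EuclideanSpace ℝ (Fin q)) ×
      (PiLp 2 fun _ : Fin q => EuclideanSpace ℝ (Fin k)) → Set (Fin d → Fin q × Fin q → ℝ) :=
    fun p => {g | ‖arrayCLM g (factorProd q k p.1 p.2)‖ ^ 2 ∉
      Set.Icc ((1 - ε) * ‖factorProd q k p.1 p.2‖ ^ 2) ((1 + ε) * ‖factorProd q k p.1 p.2‖ ^ 2)}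
  have hsub : {g | ¬ IsRestrictedIsometryBound (arrayMap g) k (5 * ε)} ⊆
      ⋃ p ∈ s ×ˢ t, bad p := by
    intro g hg
    by_contra hcon
    simp only [Set.mem_iUnion, not_exists] at hcon
    refine hg (isRestrictedIsometryBound_of_nets hε0 hε1 (s := (s : Set _)) (t := (t : Set _))
      hs1 ht1 hs ht g fun U hU V hV => ?_)
    by_contra hmem
    exact hcon (U, V) (Finset.mk_mem_product hU hV) hmem
  refine (measure_mono hsub).trans ((measure_biUnion_finset_le _ _).trans ?_)
  refine (Finset.sum_le_sum fun p _ =>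
    measure_norm_sq_arrayCLM_not_mem_Icc hd hε0 (hε1.trans (by norm_num)) _).trans ?_
  rw [Finset.sum_const, nsmul_eq_mul, ← ENNReal.ofReal_natCast, ← ENNReal.ofReal_mul (by positivity)]
  apply ENNReal.ofReal_le_ofReal
  have hbase : 1 + 2 / (ε / 8) = Real.exp (Real.log (1 + 16 / ε)) := by
    rw [Real.exp_log (by positivity)]; field_simp; ring
  -- The net count uses half of the exponent ε²/8 of the pointwise tail.
  have hcard : ((s ×ˢ t).card : ℝ) ≤ Real.exp (ε ^ 2 / 16 * d) := by
    rw [Finset.card_product]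
    push_cast
    calc (s.card : ℝ) * t.card
        ≤ (1 + 2 / (ε / 8)) ^ (q * k) * (1 + 2 / (ε / 8)) ^ (q * k) := by gcongr
      _ = Real.exp (2 * (q * k : ℕ) * Real.log (1 + 16 / ε)) := by
        rw [hbase, ← Real.exp_nat_mul, ← Real.exp_add]; congr 1; ring
      _ ≤ _ := Real.exp_le_exp.2 hk
  calc ((s ×ˢ t).card : ℝ) * (2 * Real.exp (-(ε ^ 2 / 8) * d))
      ≤ Real.exp (ε ^ 2 / 16 * d) * (2 * Real.exp (-(ε ^ 2 / 8) * d)) := by gcongr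
    _ = 2 * Real.exp (-(ε ^ 2 / 16) * d) := by
      rw [mul_left_comm, ← Real.exp_add]; congr 2; ring

/-- The operator norm estimate needs a bound below 25/98 · 4.95 - 1/200 ≈ 1.2577, and log(7/2) ≈
1.2528. -/
theorem log_seven_halves_le : Real.log (7 / 2) ≤ 1.2535 := by
  rw [Real.log_le_iff_le_exp (by norm_num)]
  have h1 := Real.exp_one_gt_d9
  have h2 := Real.sum_le_exp_of_nonneg (x := 0.2535) (by norm_num) 5
  simp only [Finset.sum_range_succ, Finset.sum_range_zero, Nat.factorial] at h2
  norm_num at h2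
  have h3 : Real.exp 1.2535 = Real.exp 1 * Real.exp 0.2535 := by
    rw [← Real.exp_add]; norm_num
  rw [h3]
  norm_num at h1 ⊢
  nlinarith

/-- Gaussian maps satisfy a sharp operator norm bound with overwhelming probability. -/
theorem measure_not_norm_sq_arrayMap_le (hd : 1 ≤ d) (hdq : d ≤ q ^ 2) :
    gaussianArray (Fin d) (Fin q × Fin q) (1 / (d : ℝ≥0))
        {g | ¬ ∀ X : Matrix (Fin q) (Fin q) ℝ,
          ‖arrayMap g X‖ ^ 2 ≤ 4.95 * (q : ℝ) ^ 2 / d * ‖X‖ ^ 2} ≤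
      ENNReal.ofReal (Real.exp (-(1 / 200) * d)) := by
  have hd0 : (0 : ℝ) < d := by exact_mod_cast hd
  have hq : 0 < q := by
    rcases Nat.eq_zero_or_pos q with rfl | h
    · simp at hdq; omega
    · exact h
  have hdq' : (d : ℝ) ≤ (q : ℝ) ^ 2 := by exact_mod_cast hdq
  have : Nonempty (Fin d) := ⟨⟨0, hd⟩⟩
  have : Nonempty (Fin q) := ⟨⟨0, hq⟩⟩
  set t := √(4.95 * (q : ℝ) ^ 2 / d) with ht
  have ht2 : t ^ 2 = 4.95 * (q : ℝ) ^ 2 / d := Real.sq_sqrt (by positivity)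
  have ht0 : 0 ≤ t := Real.sqrt_nonneg _
  -- For s = a², the best β is s t d, and in the worst case d = q² the exponent is positive when
  -- 4.95 s²/2 + log(1 - s) > 0. The value s = 5/7 is near the optimum; the method works for
  -- constants above about 4.91, hence for 4.95, leaving room below 5.
  set a := √(5 / 7 : ℝ) with ha
  have ha2 : a ^ 2 = 5 / 7 := Real.sq_sqrt (by norm_num)
  have htail := gaussianArray_exists_bilin_ge (ι := Fin d) (κ := Fin q × Fin q)
    (v := 1 / (d : ℝ≥0)) (β := 5 / 7 * t * d) (by positivity) (a := a) (by rw [ha2]; norm_num) t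
  refine le_trans (measure_mono ?_) (htail.trans (ENNReal.ofReal_le_ofReal ?_))
  · intro g hg
    simp only [Set.mem_ofPred_eq, not_forall, not_le] at hg ⊢
    obtain ⟨X, hX⟩ := hg
    have hXpos : 0 < ‖X‖ := by
      rw [norm_pos_iff]; rintro rfl; simp at hX
    have hLpos : 0 < ‖arrayMap g X‖ := by
      rw [norm_pos_iff]; intro h0; rw [h0] at hX
      have : 0 ≤ 4.95 * (q : ℝ) ^ 2 / d * ‖X‖ ^ 2 := by positivity
      simp at hX; linarith
    rw [← ht2, ← mul_pow] at hX
    have hX' : t * ‖X‖ < ‖arrayMap g X‖ := lt_of_pow_lt_pow_left₀ 2 (norm_nonneg _) hX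
    refine ⟨fun i => ‖arrayMap g X‖⁻¹ * arrayMap g X i, fun p => ‖X‖⁻¹ * X p.1 p.2, ?_, ?_, ?_⟩
    · have := EuclideanSpace.norm_sq_eq (arrayMap g X)
      simp only [Real.norm_eq_abs, sq_abs] at this
      simp_rw [mul_pow]
      rw [← Finset.mul_sum, ← this]
      field_simp
    · simp_rw [mul_pow]
      rw [← Finset.mul_sum, ← frobenius_norm_sq_eq_sum_prod]
      field_simp
    · have hsum : ∑ i, (∑ p : Fin q × Fin q, ‖X‖⁻¹ * X p.1 p.2 * g i p) *
          (‖arrayMap g X‖⁻¹ * arrayMap g X i) = ‖X‖⁻¹ * ‖arrayMap g X‖⁻¹ * ‖arrayMap g X‖ ^ 2 := by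
        rw [norm_sq_arrayMap, Finset.mul_sum]
        refine Finset.sum_congr rfl fun i _ => ?_
        simp_rw [mul_assoc, ← Finset.mul_sum, arrayMap_apply]
        ring
      rw [hsum]
      have : ‖X‖⁻¹ * ‖arrayMap g X‖⁻¹ * ‖arrayMap g X‖ ^ 2 = ‖arrayMap g X‖ / ‖X‖ := by
        field_simp
      rw [this, le_div_iff₀ hXpos]
      exact hX'.le
  · rw [Real.exp_le_exp, ha2]
    have hlog : Real.log (1 - 5 / 7) = -Real.log (7 / 2) := by
      rw [← Real.log_inv]; norm_num
    rw [hlog]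
    simp only [Fintype.card_prod, Fintype.card_fin]
    push_cast
    have e1 : 5 / 7 * (5 / 7 * t * d) * t - (5 / 7 * t * d) ^ 2 * (1 / (d : ℝ)) / 2 =
        25 / 98 * (4.95 * (q : ℝ) ^ 2) := by
      have : t ^ 2 * d = 4.95 * (q : ℝ) ^ 2 := by rw [ht2]; field_simp
      rw [← this]
      field_simp
      ring
    rw [e1]
    have h7 := log_seven_halves_le
    have h70 : 0 ≤ Real.log (7 / 2) := Real.log_nonneg (by norm_num)
    have e2 : ((d : ℝ) + q * q) * Real.log (7 / 2) ≤ (2 * q ^ 2) * 1.2535 := by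
      apply mul_le_mul _ h7 h70 (by positivity)
      nlinarith
    nlinarith

end GaussianMaps

end LowRankMap

/-! ### Operator scaling of near rank-one isometries -/

namespace Matrix

section Scaling

variable {n ι : Type*} [Fintype n] [Fintype ι]

/-- The completely positive map `Q ↦ ∑ Aᵢ Q Aᵢᵀ` on matrices. -/
def krausMap (A : ι → Matrix n n ℝ) (Q : Matrix n n ℝ) : Matrix n n ℝ :=
  ∑ i, A i * Q * (A i)ᵀ

/-- `∑ (xᵀ Aᵢ y)²` is within relative distance `ε` of `|x|² |y|²` for all `x` and `y`. -/
def IsRankOneNearIsometry (A : ι → Matrix n n ℝ) (ε : ℝ) : Prop :=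
  ∀ x y : n → ℝ, (1 - ε) * ((x ⬝ᵥ x) * (y ⬝ᵥ y)) ≤ ∑ i, (x ⬝ᵥ A i *ᵥ y) ^ 2 ∧
    ∑ i, (x ⬝ᵥ A i *ᵥ y) ^ 2 ≤ (1 + ε) * ((x ⬝ᵥ x) * (y ⬝ᵥ y))

theorem IsRankOneNearIsometry.transpose {A : ι → Matrix n n ℝ} {ε : ℝ}
    (h : IsRankOneNearIsometry A ε) : IsRankOneNearIsometry (fun i => (A i)ᵀ) ε := by
  intro x y
  have hx : ∀ i, x ⬝ᵥ (A i)ᵀ *ᵥ y = y ⬝ᵥ A i *ᵥ x := fun i => by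
    rw [mulVec_transpose, dotProduct_comm, ← dotProduct_mulVec]
  simp_rw [hx]
  rw [mul_comm (x ⬝ᵥ x)]
  exact h y x

/-- The sum of the squares of the entries. -/
def sumSq (M : Matrix n n ℝ) : ℝ := ∑ a, M a ⬝ᵥ M a

theorem sumSq_nonneg (M : Matrix n n ℝ) : 0 ≤ sumSq M :=
  Finset.sum_nonneg fun _ _ => dotProduct_self_star_nonneg _

theorem sumSq_transpose (M : Matrix n n ℝ) : sumSq Mᵀ = sumSq M := by
  simp only [sumSq, dotProduct, transpose_apply]
  exact Finset.sum_comm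

theorem sumSq_pos {M : Matrix n n ℝ} (h : M ≠ 0) : 0 < sumSq M := by
  refine lt_of_le_of_ne (sumSq_nonneg M) fun h0 => h ?_
  have := (Finset.sum_eq_zero_iff_of_nonneg
    (fun a _ => dotProduct_self_star_nonneg (M a))).1 h0.symm
  ext a b
  have h1 := this a (Finset.mem_univ a)
  have h2 : M a = 0 := dotProduct_self_eq_zero.1 h1
  simp [h2]

theorem krausMap_transpose (A : ι → Matrix n n ℝ) (Q : Matrix n n ℝ) :
    (krausMap A Q)ᵀ = krausMap A Qᵀ := by
  simp [krausMap, transpose_sum, transpose_mul, mul_assoc]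

theorem krausMap_add_smul (A : ι → Matrix n n ℝ) (Q H : Matrix n n ℝ) (s : ℝ) :
    krausMap A (Q + s • H) = krausMap A Q + s • krausMap A H := by
  simp [krausMap, mul_add, add_mul, Finset.sum_add_distrib, Finset.smul_sum]

theorem krausMap_smul (A : ι → Matrix n n ℝ) (Q : Matrix n n ℝ) (s : ℝ) :
    krausMap A (s • Q) = s • krausMap A Q := by
  simp [krausMap, Finset.smul_sum]

theorem continuous_krausMap (A : ι → Matrix n n ℝ) : Continuous (krausMap A) := by
  unfold krausMap; fun_prop

theorem trace_mul_krausMap (A : ι → Matrix n n ℝ) (R H : Matrix n n ℝ) :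
    trace (R * krausMap A H) = trace (krausMap (fun i => (A i)ᵀ) R * H) := by
  simp only [krausMap, Finset.mul_sum, Finset.sum_mul, trace_sum, transpose_transpose]
  refine Finset.sum_congr rfl fun i _ => ?_
  rw [← mul_assoc, trace_mul_comm]
  simp only [mul_assoc]

/-- BᵀB is the sum of the rank-one matrices bbᵀ over the rows b of `B`, so the quadratic form only
tests the map on rank-one matrices. -/
theorem dotProduct_krausMap_mulVec (A : ι → Matrix n n ℝ) (B : Matrix n n ℝ) (x : n → ℝ) :
    x ⬝ᵥ krausMap A (Bᵀ * B) *ᵥ x = ∑ a, ∑ i, (x ⬝ᵥ A i *ᵥ B a) ^ 2 := by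
  rw [Finset.sum_comm, krausMap, sum_mulVec, dotProduct_sum]
  refine Finset.sum_congr rfl fun i _ => ?_
  have h1 : x ⬝ᵥ (A i * (Bᵀ * B) * (A i)ᵀ) *ᵥ x =
      (B *ᵥ ((A i)ᵀ *ᵥ x)) ⬝ᵥ (B *ᵥ ((A i)ᵀ *ᵥ x)) := by
    rw [← mulVec_mulVec, ← mulVec_mulVec, ← mulVec_mulVec, dotProduct_mulVec x,
      ← mulVec_transpose, dotProduct_mulVec _ Bᵀ, vecMul_transpose]
  rw [h1, dotProduct]
  refine Finset.sum_congr rfl fun a _ => ?_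
  have h2 : (B *ᵥ ((A i)ᵀ *ᵥ x)) a = x ⬝ᵥ A i *ᵥ B a := by
    change B a ⬝ᵥ _ = _
    rw [mulVec_transpose, dotProduct_comm, ← dotProduct_mulVec]
  rw [h2, sq]

theorem IsRankOneNearIsometry.krausMap_bounds {A : ι → Matrix n n ℝ} {ε : ℝ}
    (h : IsRankOneNearIsometry A ε) (B : Matrix n n ℝ) (x : n → ℝ) :
    (1 - ε) * (sumSq B * (x ⬝ᵥ x)) ≤ x ⬝ᵥ krausMap A (Bᵀ * B) *ᵥ x ∧
      x ⬝ᵥ krausMap A (Bᵀ * B) *ᵥ x ≤ (1 + ε) * (sumSq B * (x ⬝ᵥ x)) := by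
  rw [dotProduct_krausMap_mulVec, sumSq, Finset.sum_mul, Finset.mul_sum, Finset.mul_sum]
  constructor <;> refine Finset.sum_le_sum fun a _ => ?_
  · rw [mul_comm (B a ⬝ᵥ B a)]; exact (h x (B a)).1
  · rw [mul_comm (B a ⬝ᵥ B a)]; exact (h x (B a)).2

theorem IsRankOneNearIsometry.posDef_krausMap {A : ι → Matrix n n ℝ} {ε : ℝ}
    (h : IsRankOneNearIsometry A ε) (hε1 : ε < 1) {B : Matrix n n ℝ} (hB : B ≠ 0) :
    (krausMap A (Bᵀ * B)).PosDef := by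
  refine PosDef.of_dotProduct_mulVec_pos ?_ fun {x} hx => ?_
  · rw [IsHermitian, conjTranspose_eq_transpose_of_trivial, krausMap_transpose]
    simp
  · rw [star_trivial]
    refine lt_of_lt_of_le ?_ (h.krausMap_bounds B x).1
    have hx' : 0 < x ⬝ᵥ x := by
      have := dotProduct_self_star_pos_iff.2 hx
      simpa using this
    exact mul_pos (by linarith) (mul_pos (sumSq_pos hB) hx')

theorem eq_of_forall_dotProduct_mulVec {M N : Matrix n n ℝ} (hM : Mᵀ = M) (hN : Nᵀ = N)
    (h : ∀ v, v ⬝ᵥ M *ᵥ v = v ⬝ᵥ N *ᵥ v) : M = N := by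
  open scoped MatrixOrder in
  refine le_antisymm ?_ ?_
  · rw [Matrix.le_iff]
    refine PosSemidef.of_dotProduct_mulVec_nonneg ?_ fun v => ?_
    · rw [IsHermitian, conjTranspose_eq_transpose_of_trivial, transpose_sub, hM, hN]
    · simp [sub_mulVec, h]
  · rw [Matrix.le_iff]
    refine PosSemidef.of_dotProduct_mulVec_nonneg ?_ fun v => ?_
    · rw [IsHermitian, conjTranspose_eq_transpose_of_trivial, transpose_sub, hM, hN]
    · simp [sub_mulVec, h]

section

variable [DecidableEq n]

/-- Since the Kraus image of BᵀB is close to ‖B‖² I, the balance equation makes |Py|² close to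
c|y|²/‖B‖²; apply this to the columns of `M`. -/
theorem IsRankOneNearIsometry.scaled_bounds {A : ι → Matrix n n ℝ} {ε : ℝ}
    (h : IsRankOneNearIsometry A ε) {P B : Matrix n n ℝ} {c : ℝ}
    (hPB : Pᵀ * krausMap A (Bᵀ * B) * P = c • 1) (M : Matrix n n ℝ) :
    (1 - ε) * (sumSq B * sumSq (P * M)) ≤ c * sumSq M ∧
      c * sumSq M ≤ (1 + ε) * (sumSq B * sumSq (P * M)) := by
  have hy : ∀ y : n → ℝ, (P *ᵥ y) ⬝ᵥ krausMap A (Bᵀ * B) *ᵥ (P *ᵥ y) = c * (y ⬝ᵥ y) := by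
    intro y
    have : (P *ᵥ y) ⬝ᵥ krausMap A (Bᵀ * B) *ᵥ (P *ᵥ y) =
        y ⬝ᵥ (Pᵀ * krausMap A (Bᵀ * B) * P) *ᵥ y := by
      rw [← mulVec_mulVec, ← mulVec_mulVec, dotProduct_mulVec y, vecMul_transpose]
    rw [this, hPB, smul_mulVec, one_mulVec, dotProduct_smul, smul_eq_mul]
  have hcol : ∀ M : Matrix n n ℝ, sumSq M = ∑ b, Mᵀ b ⬝ᵥ Mᵀ b := fun M =>
    (sumSq_transpose M).symm
  have hcol' : ∀ b, (P * M)ᵀ b = P *ᵥ Mᵀ b := fun b => by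
    ext a; simp [mulVec, mul_apply, dotProduct]
  rw [hcol M, hcol (P * M), Finset.mul_sum, Finset.mul_sum, Finset.mul_sum, Finset.mul_sum]
  constructor <;> refine Finset.sum_le_sum fun b _ => ?_
  · rw [← hy, hcol']; exact (h.krausMap_bounds B _).1
  · rw [← hy, hcol']; exact (h.krausMap_bounds B _).2

theorem sumSq_one : sumSq (1 : Matrix n n ℝ) = Fintype.card n := by
  simp [sumSq, dotProduct, one_apply]

/-- A scaling that makes a near rank-one isometry doubly balanced is a near isometry. -/
theorem IsRankOneNearIsometry.sumSq_scaling_bounds [Nonempty n] {A : ι → Matrix n n ℝ} {ε : ℝ}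
    (h : IsRankOneNearIsometry A ε) (hε0 : 0 ≤ ε) (hε1 : ε < 1) {P₁ P₂ : Matrix n n ℝ}
    (hs1 : P₁ᵀ = P₁) (hs2 : P₂ᵀ = P₂)
    (h1 : P₁ * krausMap A (P₂ * P₂) * P₁ = (Fintype.card n : ℝ) • 1)
    (h2 : P₂ * krausMap (fun i => (A i)ᵀ) (P₁ * P₁) * P₂ = (Fintype.card n : ℝ) • 1)
    (X : Matrix n n ℝ) :
    (1 - ε) / (1 + ε) ^ 2 * sumSq X ≤ sumSq (P₁ * X * P₂) ∧
      sumSq (P₁ * X * P₂) ≤ (1 + ε) / (1 - ε) ^ 2 * sumSq X := by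
  have hn : (0 : ℝ) < Fintype.card n := by exact_mod_cast Fintype.card_pos
  have b1 := h.scaled_bounds (P := P₁) (B := P₂) (by rw [hs1, hs2]; exact h1)
  have b2 := h.transpose.scaled_bounds (P := P₂) (B := P₁) (by rw [hs1, hs2]; exact h2)
  -- Taking M = 1 puts ‖P₁‖²‖P₂‖² near q². Only the product can be controlled, since (λP₁, λ⁻¹P₂)
  -- gives the same map.
  obtain ⟨o1, o2⟩ := b1 1
  rw [mul_one, sumSq_one] at o1 o2
  obtain ⟨x1, x2⟩ := b1 (X * P₂)
  obtain ⟨y1, y2⟩ := b2 Xᵀ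
  have hXP : sumSq (P₂ * Xᵀ) = sumSq (X * P₂) := by
    rw [← sumSq_transpose, transpose_mul, transpose_transpose, hs2]
  rw [hXP, sumSq_transpose] at y1 y2
  rw [← mul_assoc P₁] at x1 x2
  set N := sumSq (P₁ * X * P₂)
  set Y := sumSq (X * P₂)
  set Z := sumSq X
  set s := sumSq P₁
  set t := sumSq P₂
  have hs0 : 0 ≤ s := sumSq_nonneg _
  have ht0 : 0 ≤ t := sumSq_nonneg _
  have hN0 : 0 ≤ N := sumSq_nonneg _
  have hY0 : 0 ≤ Y := sumSq_nonneg _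
  have hZ0 : 0 ≤ Z := sumSq_nonneg _
  set m : ℝ := (Fintype.card n : ℝ)
  have hst : 0 < t * s := by
    by_contra! hcon
    have : (1 + ε) * (t * s) ≤ 0 := mul_nonpos_of_nonneg_of_nonpos (by linarith) hcon
    nlinarith
  constructor
  · rw [div_mul_eq_mul_div, div_le_iff₀ (by positivity)]
    have e1 : m * (m * Z) ≤ (1 + ε) ^ 2 * (t * s) * N := by
      calc m * (m * Z) ≤ m * ((1 + ε) * (s * Y)) := by gcongr
        _ = (1 + ε) * s * (m * Y) := by ring
        _ ≤ (1 + ε) * s * ((1 + ε) * (t * N)) := by gcongr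
        _ = _ := by ring
    have e2 : (1 - ε) * (t * s) * Z ≤ m * m * Z := by gcongr
    have e3 : (t * s) * ((1 - ε) * Z) ≤ (t * s) * (N * (1 + ε) ^ 2) := by linarith
    exact le_of_mul_le_mul_left e3 hst
  · have h1ε : 0 < 1 - ε := by linarith
    rw [div_mul_eq_mul_div, le_div_iff₀ (by positivity)]
    have e1 : (1 - ε) ^ 2 * (t * s) * N ≤ m * (m * Z) := by
      calc (1 - ε) ^ 2 * (t * s) * N = (1 - ε) * s * ((1 - ε) * (t * N)) := by ring
        _ ≤ (1 - ε) * s * (m * Y) := by gcongr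
        _ = m * ((1 - ε) * (s * Y)) := by ring
        _ ≤ m * (m * Z) := by gcongr
    have e2 : m * m * Z ≤ (1 + ε) * (t * s) * Z := by gcongr
    have e3 : (t * s) * (N * (1 - ε) ^ 2) ≤ (t * s) * ((1 + ε) * Z) := by linarith
    exact le_of_mul_le_mul_left e3 hst

theorem hasDerivAt_det_add_smul {M : Matrix n n ℝ} (hM : IsUnit M.det) (H : Matrix n n ℝ) :
    HasDerivAt (fun s : ℝ => (M + s • H).det) (M.det * trace (M⁻¹ * H)) 0 := by
  -- After factoring out `M`, det(1 + sM⁻¹H) is a polynomial in s beginning 1 + s tr(M⁻¹H).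
  have hfun : (fun s : ℝ => (M + s • H).det) = fun s => M.det * (1 + trace (M⁻¹ * H) * s +
      (det (1 + (Polynomial.X : Polynomial ℝ) • (M⁻¹ * H).map Polynomial.C)).divX.divX.eval s *
        s ^ 2) := by
    ext s
    rw [← det_one_add_smul, ← det_mul, mul_add, mul_one, mul_smul_comm, ← mul_assoc,
      mul_nonsing_inv _ hM, one_mul]
  rw [hfun]
  set p := (det (1 + (Polynomial.X : Polynomial ℝ) • (M⁻¹ * H).map Polynomial.C)).divX.divX
  have h1 : HasDerivAt (fun s : ℝ => trace (M⁻¹ * H) * s) (trace (M⁻¹ * H)) 0 := by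
    simpa using (hasDerivAt_id (0 : ℝ)).const_mul (trace (M⁻¹ * H))
  have h2 : HasDerivAt (fun s : ℝ => p.eval s * s ^ 2) 0 0 := by
    simpa using (p.hasDerivAt 0).fun_mul (hasDerivAt_pow 2 (0 : ℝ))
  simpa using ((h1.const_add 1).add h2).const_mul M.det

theorem PosDef.exists_posDef_sqrt {Q : Matrix n n ℝ} (hQ : Q.PosDef) :
    ∃ P : Matrix n n ℝ, P.PosDef ∧ P * P = Q := by
  open scoped MatrixOrder in
  have hPP : CFC.sqrt Q * CFC.sqrt Q = Q := CFC.sqrt_mul_sqrt_self Q hQ.posSemidef.nonneg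
  refine ⟨CFC.sqrt Q, ?_, hPP⟩
  rw [(nonneg_iff_posSemidef.1 (CFC.sqrt_nonneg Q)).posDef_iff_isUnit]
  exact isUnit_of_mul_isUnit_left (hPP.symm ▸ hQ.isUnit)

theorem PosSemidef.exists_transpose_mul_self {Q : Matrix n n ℝ} (hQ : Q.PosSemidef) :
    ∃ B : Matrix n n ℝ, Bᵀ * B = Q := by
  open scoped MatrixOrder in
  refine ⟨CFC.sqrt Q, ?_⟩
  have hP : (CFC.sqrt Q)ᵀ = CFC.sqrt Q := by
    have := (nonneg_iff_posSemidef.1 (CFC.sqrt_nonneg Q)).isHermitian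
    rwa [IsHermitian, conjTranspose_eq_transpose_of_trivial] at this
  rw [hP]
  exact CFC.sqrt_mul_sqrt_self Q hQ.nonneg

/-- The ratio det Q / det T(Q) is homogeneous of degree 0 and continuous away from 0, so it is
maximized on a compact sphere. Writing Q = BᵀB includes singular Q, where the ratio is 0 and so
below its value at the identity. The constant `c` is the maximum, with the denominator cleared for
differentiation. -/
theorem IsRankOneNearIsometry.exists_maximizer [Nonempty n] {A : ι → Matrix n n ℝ} {ε : ℝ}
    (h : IsRankOneNearIsometry A ε) (hε1 : ε < 1) :
    ∃ (B₀ : Matrix n n ℝ) (c : ℝ), B₀.det ≠ 0 ∧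
      (B₀ᵀ * B₀).det = c * (krausMap A (B₀ᵀ * B₀)).det ∧
      ∀ B : Matrix n n ℝ, (Bᵀ * B).det ≤ c * (krausMap A (Bᵀ * B)).det := by
  let f : Matrix n n ℝ → ℝ := fun B => (Bᵀ * B).det / (krausMap A (Bᵀ * B)).det
  let S : Set (Matrix n n ℝ) := {B | sumSq B = 1}
  have hne : ∀ B ∈ S, B ≠ 0 := by
    rintro B hB rfl
    have : sumSq (0 : Matrix n n ℝ) = 1 := hB
    simp [sumSq, dotProduct] at this
  have hpos : ∀ B : Matrix n n ℝ, B ≠ 0 → 0 < (krausMap A (Bᵀ * B)).det := fun B hB =>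
    (h.posDef_krausMap hε1 hB).det_pos
  have hcont : ContinuousOn f S := by
    refine ContinuousOn.div ?_ ?_ fun B hB => (hpos B (hne B hB)).ne'
    · exact Continuous.continuousOn (by fun_prop)
    · exact (((continuous_krausMap A).comp (by fun_prop :
        Continuous fun B : Matrix n n ℝ => Bᵀ * B)).matrix_det).continuousOn
  have hcompact : IsCompact S := by
    have hbox : IsCompact (Set.pi Set.univ fun _ : n => Set.pi Set.univ fun _ : n =>
        Set.Icc (-1 : ℝ) 1) := isCompact_univ_pi fun _ => isCompact_univ_pi fun _ => isCompact_Icc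
    refine IsCompact.of_isClosed_subset (X := Matrix n n ℝ) hbox
      (isClosed_eq ?_ continuous_const) ?_
    · unfold sumSq dotProduct; fun_prop
    · intro B hB a _ b _
      have hB1 : sumSq B = 1 := hB
      have h1 : B a ⬝ᵥ B a ≤ 1 := hB1 ▸ Finset.single_le_sum (f := fun a => B a ⬝ᵥ B a)
        (fun a _ => dotProduct_self_star_nonneg (B a)) (Finset.mem_univ a)
      have h2 : B a b * B a b ≤ B a ⬝ᵥ B a := Finset.single_le_sum (f := fun b => B a b * B a b)
        (fun b _ => mul_self_nonneg _) (Finset.mem_univ b)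
      exact abs_le.1 (abs_le_one_iff_mul_self_le_one.2 (h2.trans h1))
  have hsmul : ∀ (B : Matrix n n ℝ) (t : ℝ), sumSq (t • B) = t ^ 2 * sumSq B := by
    intro B t
    simp only [sumSq, smul_apply, dotProduct, Finset.mul_sum, smul_eq_mul]
    exact Finset.sum_congr rfl fun a _ => Finset.sum_congr rfl fun b _ => by ring
  have hnormalize : ∀ B : Matrix n n ℝ, B ≠ 0 → ∃ t : ℝ, 0 < t ∧ t • B ∈ S := by
    intro B hB
    have hB0 := sumSq_pos hB
    refine ⟨(√(sumSq B))⁻¹, by positivity, ?_⟩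
    change sumSq _ = 1
    rw [hsmul, inv_pow, Real.sq_sqrt hB0.le, inv_mul_cancel₀ hB0.ne']
  have hf : ∀ (B : Matrix n n ℝ) (t : ℝ), 0 < t → f (t • B) = f B := by
    intro B t ht
    have e : (t • B)ᵀ * (t • B) = (t ^ 2) • (Bᵀ * B) := by
      rw [transpose_smul, smul_mul_smul_comm, sq]
    simp only [f, e, krausMap_smul, det_smul]
    exact mul_div_mul_left _ _ (by positivity)
  obtain ⟨t₁, ht₁, hS₁⟩ := hnormalize (1 : Matrix n n ℝ) one_ne_zero
  obtain ⟨B₀, hB₀, hmax⟩ := hcompact.exists_isMaxOn ⟨_, hS₁⟩ hcont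
  have hmax' : ∀ B : Matrix n n ℝ, B ≠ 0 → f B ≤ f B₀ := by
    intro B hB
    obtain ⟨t, ht, htS⟩ := hnormalize B hB
    rw [← hf B t ht]
    exact hmax htS
  have hf1 : 0 < f 1 := by
    have := hpos 1 one_ne_zero
    simp only [f, transpose_one, one_mul, det_one] at this ⊢
    positivity
  have hf0 : 0 < f B₀ := hf1.trans_le (hmax' 1 one_ne_zero)
  refine ⟨B₀, f B₀, fun hdet => ?_, ?_, fun B => ?_⟩
  · simp [f, hdet] at hf0
  · exact (div_mul_cancel₀ _ (hpos B₀ (hne B₀ hB₀)).ne').symm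
  · rcases eq_or_ne B 0 with rfl | hB
    · simp [krausMap, det_zero]
    · exact (div_le_iff₀ (hpos B hB)).1 (hmax' B hB)

theorem posSemidef_one_add_smul_vecMulVec {z : n → ℝ} {s : ℝ} (hs : |s| * (z ⬝ᵥ z) ≤ 1) :
    (1 + s • vecMulVec z z).PosSemidef := by
  refine PosSemidef.of_dotProduct_mulVec_nonneg ?_ fun x => ?_
  · rw [IsHermitian, conjTranspose_eq_transpose_of_trivial, transpose_add, transpose_one,
      transpose_smul, transpose_vecMulVec]
  · have hx : x ⬝ᵥ (1 + s • vecMulVec z z) *ᵥ x = x ⬝ᵥ x + s * (z ⬝ᵥ x) ^ 2 := by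
      rw [add_mulVec, one_mulVec, dotProduct_add, smul_mulVec, vecMulVec_mulVec]
      simp [dotProduct_comm x z, sq]
    rw [star_trivial, hx]
    have hcs : (z ⬝ᵥ x) ^ 2 ≤ (z ⬝ᵥ z) * (x ⬝ᵥ x) := by
      have := Finset.sum_mul_sq_le_sq_mul_sq Finset.univ z x
      simpa [dotProduct, sq] using this
    have hxx : 0 ≤ x ⬝ᵥ x := dotProduct_self_star_nonneg x
    have h1 : -|s| ≤ s := neg_abs_le s
    have h2 : |s| * (z ⬝ᵥ x) ^ 2 ≤ |s| * ((z ⬝ᵥ z) * (x ⬝ᵥ x)) := by gcongr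
    have h3 : |s| * (z ⬝ᵥ z) * (x ⬝ᵥ x) ≤ 1 * (x ⬝ᵥ x) := by gcongr
    have h4 : -|s| * (z ⬝ᵥ x) ^ 2 ≤ s * (z ⬝ᵥ x) ^ 2 := by gcongr
    linarith

/-- Stationarity of log det Q - log det T(Q) in direction H reads tr(Q⁻¹H) = tr(T(Q)⁻¹T(H)) =
tr(T*(T(Q)⁻¹)H). Directions H = vvᵀ suffice, as both sides are symmetric. -/
theorem IsRankOneNearIsometry.exists_fixed_point [Nonempty n] {A : ι → Matrix n n ℝ} {ε : ℝ}
    (h : IsRankOneNearIsometry A ε) (hε1 : ε < 1) :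
    ∃ Q : Matrix n n ℝ, Q.PosDef ∧ (krausMap A Q).PosDef ∧
      krausMap (fun i => (A i)ᵀ) (krausMap A Q)⁻¹ = Q⁻¹ := by
  obtain ⟨B, c, hB, hc, hmax⟩ := h.exists_maximizer hε1
  have hB0 : B ≠ 0 := by
    rintro rfl
    simp [det_zero] at hB
  have hBunit : IsUnit B := (isUnit_iff_isUnit_det B).2 hB.isUnit
  set Q := Bᵀ * B with hQdef
  have hQt : Qᵀ = Q := by simp [hQdef]
  have hQ : Q.PosDef := by
    have := PosDef.conjTranspose_mul_self B (mulVec_injective_iff_isUnit.2 hBunit)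
    rwa [conjTranspose_eq_transpose_of_trivial] at this
  have hT : (krausMap A Q).PosDef := h.posDef_krausMap hε1 hB0
  have hQu : IsUnit Q.det := hQ.det_pos.ne'.isUnit
  have hTu : IsUnit (krausMap A Q).det := hT.det_pos.ne'.isUnit
  refine ⟨Q, hQ, hT, ?_⟩
  have hinvt : (krausMap A Q)⁻¹ᵀ = (krausMap A Q)⁻¹ := by
    rw [transpose_nonsing_inv, krausMap_transpose, hQt]
  refine eq_of_forall_dotProduct_mulVec ?_ ?_ fun v => ?_
  · rw [krausMap_transpose, hinvt]
  · rw [transpose_nonsing_inv, hQt]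
  -- With v = Bᵀz, Q + sH = Bᵀ(1 + s zzᵀ)B is visibly positive semidefinite for small s of either
  -- sign, so the maximality inequality applies on both sides of 0.
  obtain ⟨z, rfl⟩ : ∃ z, v = Bᵀ *ᵥ z := by
    refine ⟨(Bᵀ)⁻¹ *ᵥ v, ?_⟩
    rw [mulVec_mulVec, mul_nonsing_inv _ (by rw [det_transpose]; exact hB.isUnit), one_mulVec]
  set v := Bᵀ *ᵥ z
  set H := vecMulVec v v with hH
  have hle : ∀ s : ℝ, |s| * (z ⬝ᵥ z) ≤ 1 →
      (Q + s • H).det - c * (krausMap A Q + s • krausMap A H).det ≤ 0 := by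
    intro s hs
    have hQs : Q + s • H = Bᵀ * (1 + s • vecMulVec z z) * B := by
      rw [mul_add, add_mul, mul_one, mul_smul_comm, smul_mul_assoc, mul_vecMulVec, vecMulVec_mul,
        ← mulVec_transpose]
    have hpsd : (Q + s • H).PosSemidef := by
      have := (posSemidef_one_add_smul_vecMulVec hs).conjTranspose_mul_mul_same B
      rwa [conjTranspose_eq_transpose_of_trivial, ← hQs] at this
    obtain ⟨C, hC⟩ := hpsd.exists_transpose_mul_self
    have := hmax C
    rw [hC, krausMap_add_smul] at this
    linarith
  have hderiv := (hasDerivAt_det_add_smul hQu H).sub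
    ((hasDerivAt_det_add_smul hTu (krausMap A H)).const_mul c)
  have hlocal : IsLocalMax ((fun s : ℝ => (Q + s • H).det) -
      fun s => c * (krausMap A Q + s • krausMap A H).det) 0 := by
    have hev : ∀ᶠ s : ℝ in nhds 0, |s| * (z ⬝ᵥ z) < 1 := by
      have : ContinuousAt (fun s : ℝ => |s| * (z ⬝ᵥ z)) 0 := by fun_prop
      exact this.eventually_lt_const (by simp)
    filter_upwards [hev] with s hs
    simp only [Pi.sub_apply, zero_smul, add_zero]
    rw [hc, sub_self]
    exact hle s hs.le
  have hzero := hlocal.hasDerivAt_eq_zero hderiv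
  rw [hc, ← mul_assoc, ← mul_sub] at hzero
  have hcd : c * (krausMap A Q).det ≠ 0 := hc ▸ hQ.det_pos.ne'
  have htr := (mul_eq_zero.1 hzero).resolve_left hcd
  rw [trace_mul_krausMap, sub_eq_zero] at htr
  have hquad : ∀ M : Matrix n n ℝ, trace (M * H) = v ⬝ᵥ M *ᵥ v := fun M => by
    rw [hH, mul_vecMulVec, trace_vecMulVec, dotProduct_comm]
  rw [hquad, hquad] at htr
  exact htr.symm

/-- Operator scaling of maps that are nearly isometric on rank-one matrices. -/
theorem IsRankOneNearIsometry.exists_scaling [Nonempty n] {A : ι → Matrix n n ℝ} {ε : ℝ}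
    (h : IsRankOneNearIsometry A ε) (hε1 : ε < 1) {c : ℝ} (hc : 0 < c) :
    ∃ P₁ P₂ : Matrix n n ℝ, P₁.PosDef ∧ P₂.PosDef ∧
      P₁ * krausMap A (P₂ * P₂) * P₁ = c • 1 ∧
      P₂ * krausMap (fun i => (A i)ᵀ) (P₁ * P₁) * P₂ = c • 1 := by
  obtain ⟨Q, hQ, hT, hfix⟩ := h.exists_fixed_point hε1
  obtain ⟨P₂, hP₂, hPQ⟩ := hQ.exists_posDef_sqrt
  obtain ⟨S, hS, hST⟩ := hT.inv.exists_posDef_sqrt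
  have hSu : IsUnit S.det := hS.det_pos.ne'.isUnit
  have hPu : IsUnit P₂.det := hP₂.det_pos.ne'.isUnit
  have hTinv : krausMap A Q = S⁻¹ * S⁻¹ := by
    rw [← mul_inv_rev, hST, nonsing_inv_nonsing_inv _ hT.det_pos.ne'.isUnit]
  have hsq : √c * √c = c := Real.mul_self_sqrt hc.le
  -- P₂ = Q^(1/2) and P₁ = √c T(Q)^(-1/2): the first balance equation is then automatic, and the
  -- second is the fixed-point equation.
  refine ⟨√c • S, P₂, hS.smul (Real.sqrt_pos.2 hc), hP₂, ?_, ?_⟩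
  · rw [hPQ, hTinv, smul_mul_assoc, smul_mul_assoc, mul_smul_comm, smul_smul, hsq, ← mul_assoc,
      mul_nonsing_inv _ hSu, one_mul, nonsing_inv_mul _ hSu]
  · rw [smul_mul_smul_comm, hsq, hST, krausMap_smul, hfix, ← hPQ, mul_inv_rev, mul_smul_comm,
      smul_mul_assoc, ← mul_assoc, mul_nonsing_inv _ hPu, one_mul, nonsing_inv_mul _ hPu]

end

end Scaling

end Matrix

/-! ### Normalization of nearly isometric maps -/

namespace LowRankMap

section Scaling

open scoped Matrix Matrix.Norms.Frobenius
open Matrix (krausMap IsRankOneNearIsometry sumSq)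

variable {q k d : ℕ}

theorem frobenius_norm_sq_eq_sumSq (X : Matrix (Fin q) (Fin q) ℝ) : ‖X‖ ^ 2 = sumSq X := by
  rw [frobenius_norm_sq]
  simp [sumSq, dotProduct, sq]

theorem ofComponents_apply_eq_trace (A : Fin d → Matrix (Fin q) (Fin q) ℝ)
    (X : Matrix (Fin q) (Fin q) ℝ) (i : Fin d) :
    ofComponents A X i = Matrix.trace ((A i)ᵀ * X) := by
  simp only [ofComponents, LinearMap.coe_mk, AddHom.coe_mk, Matrix.trace, Matrix.diag,
    Matrix.mul_apply, Matrix.transpose_apply]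
  exact Finset.sum_comm

theorem ofComponents_comp (A : Fin d → Matrix (Fin q) (Fin q) ℝ)
    {N : Matrix (Fin q) (Fin q) ℝ →ₗ[ℝ] Matrix (Fin q) (Fin q) ℝ}
    {P₁ P₂ : Matrix (Fin q) (Fin q) ℝ} (h1 : P₁ᵀ = P₁) (h2 : P₂ᵀ = P₂)
    (hN : ∀ X, N X = P₁ * X * P₂) :
    ofComponents A ∘ₗ N = ofComponents fun i => P₁ * A i * P₂ := by
  refine LinearMap.ext fun X => ?_
  ext i
  rw [LinearMap.comp_apply, hN, ofComponents_apply_eq_trace, ofComponents_apply_eq_trace,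
    Matrix.transpose_mul, Matrix.transpose_mul, h1, h2, ← mul_assoc, Matrix.trace_mul_comm]
  simp only [mul_assoc]

theorem isNormalized_comp_iff (A : Fin d → Matrix (Fin q) (Fin q) ℝ)
    {N : Matrix (Fin q) (Fin q) ℝ →ₗ[ℝ] Matrix (Fin q) (Fin q) ℝ}
    {P₁ P₂ : Matrix (Fin q) (Fin q) ℝ} (h1 : P₁ᵀ = P₁) (h2 : P₂ᵀ = P₂)
    (hN : ∀ X, N X = P₁ * X * P₂) :
    IsNormalized (ofComponents A ∘ₗ N) ↔
      P₁ * krausMap A (P₂ * P₂) * P₁ = (q : ℝ) • 1 ∧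
      P₂ * krausMap (fun i => (A i)ᵀ) (P₁ * P₁) * P₂ = (q : ℝ) • 1 := by
  simp only [IsNormalized, ofComponents_comp A h1 h2 hN, component_ofComponents, krausMap,
    Matrix.transpose_mul, h1, h2, Finset.mul_sum, Finset.sum_mul, mul_assoc,
    Matrix.transpose_transpose]

theorem transpose_eq_of_posDef {P : Matrix (Fin q) (Fin q) ℝ} (hP : P.PosDef) : Pᵀ = P := by
  have := hP.isHermitian
  rwa [Matrix.IsHermitian, Matrix.conjTranspose_eq_transpose_of_trivial] at this

theorem isRankOneNearIsometry_of_isRestrictedIsometryBound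
    {A : Fin d → Matrix (Fin q) (Fin q) ℝ} {ε : ℝ} (hk : 1 ≤ k)
    (h : IsRestrictedIsometryBound (ofComponents A) k ε) : IsRankOneNearIsometry A ε := by
  intro x y
  have h1 : ‖Matrix.vecMulVec x y‖ ^ 2 = (x ⬝ᵥ x) * (y ⬝ᵥ y) := by
    rw [frobenius_norm_sq]
    simp only [Matrix.vecMulVec_apply, dotProduct, Finset.sum_mul_sum]
    exact Finset.sum_congr rfl fun a _ => Finset.sum_congr rfl fun b _ => by ring
  have h2 : ‖ofComponents A (Matrix.vecMulVec x y)‖ ^ 2 = ∑ i, (x ⬝ᵥ A i *ᵥ y) ^ 2 := by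
    rw [EuclideanSpace.norm_sq_eq]
    refine Finset.sum_congr rfl fun i _ => ?_
    rw [Real.norm_eq_abs, sq_abs]
    congr 1
    simp only [ofComponents, LinearMap.coe_mk, AddHom.coe_mk, Matrix.vecMulVec_apply, dotProduct,
      Matrix.mulVec, Finset.mul_sum]
    exact Finset.sum_congr rfl fun a _ => Finset.sum_congr rfl fun b _ => by ring
  have := h (Matrix.vecMulVec x y) ((Matrix.rank_vecMulVec_le x y).trans hk)
  rwa [h1, h2] at this

theorem exists_isNormalized_comp (hq : 1 ≤ q) {A : Fin d → Matrix (Fin q) (Fin q) ℝ} {ε : ℝ}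
    (h : IsRankOneNearIsometry A ε) (hε1 : ε < 1) :
    ∃ N, IsPosDefRankPreserver N ∧ IsNormalized (ofComponents A ∘ₗ N) := by
  have : Nonempty (Fin q) := ⟨⟨0, hq⟩⟩
  obtain ⟨P₁, P₂, hP₁, hP₂, h1, h2⟩ := h.exists_scaling hε1 (c := (q : ℝ)) (by positivity)
  let N := LinearMap.mulLeft ℝ P₁ ∘ₗ LinearMap.mulRight ℝ P₂
  have hN : ∀ X, N X = P₁ * X * P₂ := fun X => by simp [N, mul_assoc]
  exact ⟨N, ⟨P₁, P₂, hP₁, hP₂, hN⟩, (isNormalized_comp_iff A (transpose_eq_of_posDef hP₁)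
    (transpose_eq_of_posDef hP₂) hN).2 ⟨h1, h2⟩⟩

theorem norm_sq_rankPreserver_bounds (hq : 1 ≤ q) {A : Fin d → Matrix (Fin q) (Fin q) ℝ} {ε : ℝ}
    (h : IsRankOneNearIsometry A ε) (hε0 : 0 ≤ ε) (hε1 : ε < 1)
    {N : Matrix (Fin q) (Fin q) ℝ →ₗ[ℝ] Matrix (Fin q) (Fin q) ℝ}
    (hN : IsPosDefRankPreserver N) (hnorm : IsNormalized (ofComponents A ∘ₗ N))
    (X : Matrix (Fin q) (Fin q) ℝ) :
    (1 - ε) / (1 + ε) ^ 2 * ‖X‖ ^ 2 ≤ ‖N X‖ ^ 2 ∧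
      ‖N X‖ ^ 2 ≤ (1 + ε) / (1 - ε) ^ 2 * ‖X‖ ^ 2 := by
  have : Nonempty (Fin q) := ⟨⟨0, hq⟩⟩
  obtain ⟨P₁, P₂, hP₁, hP₂, hN⟩ := hN
  obtain ⟨h1, h2⟩ := (isNormalized_comp_iff A (transpose_eq_of_posDef hP₁)
    (transpose_eq_of_posDef hP₂) hN).1 hnorm
  rw [hN, frobenius_norm_sq_eq_sumSq, frobenius_norm_sq_eq_sumSq]
  exact h.sumSq_scaling_bounds hε0 hε1 (transpose_eq_of_posDef hP₁) (transpose_eq_of_posDef hP₂)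
    (by rw [Fintype.card_fin]; exact h1) (by rw [Fintype.card_fin]; exact h2) X

theorem rank_rankPreserver_le {N : Matrix (Fin q) (Fin q) ℝ →ₗ[ℝ] Matrix (Fin q) (Fin q) ℝ}
    (hN : IsPosDefRankPreserver N) (X : Matrix (Fin q) (Fin q) ℝ) : (N X).rank ≤ X.rank := by
  obtain ⟨P₁, P₂, -, -, hN⟩ := hN
  rw [hN]
  exact (Matrix.rank_mul_le_left _ _).trans (Matrix.rank_mul_le_right _ _)

/-- Normalizing a map that is nearly isometric on low-rank matrices preserves its restricted
isometry property and its operator norm bound, with slightly worse constants. -/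
theorem normalized_comp_properties (hq : 1 ≤ q) (hk : 1 ≤ k)
    {A : Fin d → Matrix (Fin q) (Fin q) ℝ} {δ : ℝ} (hδ0 : 0 < δ) (hδ1 : δ < 1)
    (hrip : IsRestrictedIsometryBound (ofComponents A) k (δ / 1000))
    {N : Matrix (Fin q) (Fin q) ℝ →ₗ[ℝ] Matrix (Fin q) (Fin q) ℝ}
    (hN : IsPosDefRankPreserver N) (hnorm : IsNormalized (ofComponents A ∘ₗ N)) :
    ricConst (ofComponents A ∘ₗ N) k ≤ δ ∧
      ((∀ X, ‖ofComponents A X‖ ^ 2 ≤ 4.95 * (q : ℝ) ^ 2 / d * ‖X‖ ^ 2) →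
        opNorm (ofComponents A ∘ₗ N) ≤ √(5 * (q : ℝ) ^ 2 / d)) := by
  set ε := δ / 1000 with hε
  have hε0 : 0 < ε := by positivity
  have hε1 : ε < 1 / 1000 := by linarith
  have hδ : δ = 1000 * ε := by linarith
  have hone := isRankOneNearIsometry_of_isRestrictedIsometryBound hk hrip
  have hb := norm_sq_rankPreserver_bounds hq hone hε0.le (by linarith) hN hnorm
  have h1ε : 0 < 1 - ε := by linarith
  have hup : (1 + ε) / (1 - ε) ^ 2 ≤ 1 + 4 * ε := by
    rw [div_le_iff₀ (by positivity)]
    nlinarith [mul_pos hε0 hε0, mul_pos (mul_pos hε0 hε0) hε0]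
  have hlow : 1 - 3 * ε ≤ (1 - ε) / (1 + ε) ^ 2 := by
    rw [le_div_iff₀ (by positivity)]
    nlinarith [mul_pos hε0 hε0, mul_pos (mul_pos hε0 hε0) hε0]
  have hb1 : ∀ X, (1 - 3 * ε) * ‖X‖ ^ 2 ≤ ‖N X‖ ^ 2 := fun X => by
    refine le_trans ?_ (hb X).1; gcongr
  have hb2 : ∀ X, ‖N X‖ ^ 2 ≤ (1 + 4 * ε) * ‖X‖ ^ 2 := fun X => by
    refine (hb X).2.trans ?_; gcongr
  refine ⟨(isLeast_ricConst _ hq hk).2 fun X hX => ?_, fun hop => ?_⟩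
  · obtain ⟨l, u⟩ := hrip (N X) ((rank_rankPreserver_le hN X).trans hX)
    rw [LinearMap.comp_apply]
    constructor
    · refine le_trans ?_ l
      calc (1 - δ) * ‖X‖ ^ 2 ≤ ((1 - ε) * (1 - 3 * ε)) * ‖X‖ ^ 2 := by
            gcongr; nlinarith
        _ = (1 - ε) * ((1 - 3 * ε) * ‖X‖ ^ 2) := by ring
        _ ≤ _ := by gcongr; exact hb1 X
    · refine u.trans ?_
      calc (1 + ε) * ‖N X‖ ^ 2 ≤ (1 + ε) * ((1 + 4 * ε) * ‖X‖ ^ 2) := by gcongr; exact hb2 X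
        _ = ((1 + ε) * (1 + 4 * ε)) * ‖X‖ ^ 2 := by ring
        _ ≤ (1 + δ) * ‖X‖ ^ 2 := by gcongr; nlinarith
  · refine ContinuousLinearMap.opNorm_le_bound _ (Real.sqrt_nonneg _) fun X => ?_
    refine le_of_sq_le_sq ?_ (by positivity)
    rw [mul_pow, Real.sq_sqrt (by positivity)]
    change ‖ofComponents A (N X)‖ ^ 2 ≤ _
    calc ‖ofComponents A (N X)‖ ^ 2 ≤ 4.95 * (q : ℝ) ^ 2 / d * ‖N X‖ ^ 2 := hop _
      _ ≤ 4.95 * (q : ℝ) ^ 2 / d * ((1 + 4 * ε) * ‖X‖ ^ 2) := by gcongr; exact hb2 X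
      _ = (4.95 * (1 + 4 * ε)) * ((q : ℝ) ^ 2 / d * ‖X‖ ^ 2) := by ring
      -- The slack between 4.95 and 5 pays for the distortion of `N`, as 4.95 · 1.004 < 5.
      _ ≤ 5 * ((q : ℝ) ^ 2 / d * ‖X‖ ^ 2) := by gcongr; linarith
      _ = _ := by ring

end Scaling

/-! ### Transfer from the law of the array to the random matrices -/

section Probability

open scoped ENNReal

/-- A family of independent centred Gaussians indexed by a product has the law of an array. -/
theorem hasLaw_gaussianArray {ι κ Ω : Type*} [Fintype ι] [Fintype κ] [MeasurableSpace Ω]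
    {P : Measure Ω} [IsProbabilityMeasure P] {v : ℝ≥0} {f : ι × κ → Ω → ℝ}
    (hlaw : ∀ s, HasLaw (f s) (gaussianReal 0 v) P) (hind : iIndepFun f P) :
    HasLaw (fun ω i k => f (i, k) ω) (gaussianArray ι κ v) P := by
  have hm : ∀ s, AEMeasurable (f s) P := fun s => (hlaw s).aemeasurable
  refine ⟨aemeasurable_pi_lambda _ fun i => aemeasurable_pi_lambda _ fun k => hm (i, k), ?_⟩
  have hpi := (iIndepFun_iff_map_fun_eq_pi_map hm).1 hind
  simp only [(hlaw _).map_eq] at hpi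
  have hcurry := Measure.infinitePi_map_curry (fun (_ : ι) (_ : κ) => gaussianReal 0 v)
  simp only [Measure.infinitePi_eq_pi] at hcurry
  rw [gaussianArray, ← hcurry, ← hpi, AEMeasurable.map_map_of_aemeasurable
    (MeasurableEquiv.measurable _).aemeasurable (aemeasurable_pi_lambda _ hm)]
  rfl

/-- A property of a random variable that holds outside a set of small measure for its law holds on
a measurable event of large probability. -/
theorem exists_measurableSet_of_hasLaw {Ω E : Type*} [MeasurableSpace Ω] [MeasurableSpace E]
    {P : Measure Ω} [IsProbabilityMeasure P] {μ : Measure E} {Y : Ω → E} (hY : HasLaw Y μ P)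
    {good : E → Prop} {η : ℝ} (hη : 0 ≤ η) (h : μ {y | ¬ good y} ≤ ENNReal.ofReal η) :
    ∃ S : Set Ω, MeasurableSet S ∧ 1 - η ≤ P.real S ∧ ∀ ω ∈ S, good (Y ω) := by
  -- The bad set need not be measurable, so it is replaced by its measurable hull. As `Y` is only
  -- almost everywhere measurable, the complement of the preimage must in turn be shrunk to a
  -- measurable set of the same measure.
  set T := toMeasurable μ {y | ¬ good y}
  have hT : MeasurableSet T := measurableSet_toMeasurable _ _
  have hnull : NullMeasurableSet (Y ⁻¹' T)ᶜ P := (hY.aemeasurable.nullMeasurable hT).compl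
  obtain ⟨S, hS, hSm, hSeq⟩ := hnull.exists_measurable_subset_ae_eq
  refine ⟨S, hSm, ?_, fun ω hω => ?_⟩
  · have hPT : P (Y ⁻¹' T) ≤ ENNReal.ofReal η := by
      rw [← Measure.map_apply_of_aemeasurable hY.aemeasurable hT, hY.map_eq, measure_toMeasurable]
      exact h
    have hreal : P.real (Y ⁻¹' T) ≤ η := ENNReal.toReal_le_of_le_ofReal hη hPT
    rw [measureReal_congr hSeq, probReal_compl_eq_one_sub₀ (hY.aemeasurable.nullMeasurable hT)]
    linarith
  · by_contra hbad
    exact hS hω (subset_toMeasurable μ _ hbad)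

end Probability

end LowRankMap

/-! ### Choice of constants and conclusion -/

theorem mainTheorem3 (δ : ℝ) (hδ0 : 0 < δ) (hδ1 : δ < 1) :
    ∃ c₁ c₂ c₃ : ℝ, 0 < c₁ ∧ 0 < c₂ ∧ 0 < c₃ ∧
      ∀ (q r d : ℕ), 1 ≤ q → 1 ≤ r → c₁ * q * (r + Real.log q) ≤ d →
      ∀ {Ω : Type*} [MeasurableSpace Ω] (P : Measure Ω) [IsProbabilityMeasure P]
        (A : Fin d → Ω → Matrix (Fin q) (Fin q) ℝ),
        (∀ i a b, HasLaw (fun ω => A i ω a b) (gaussianReal 0 (1 / (d : ℝ≥0))) P) →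
        iIndepFun (fun (s : Fin d × Fin q × Fin q) ω => A s.1 ω s.2.1 s.2.2) P →
        ∃ E : Set Ω, MeasurableSet E ∧ 1 - c₂ * Real.exp (-c₃ * d) < P.real E ∧
          ∀ ω ∈ E,
            (∃ N, LowRankMap.IsPosDefRankPreserver N ∧
              LowRankMap.IsNormalized (LowRankMap.ofComponents (fun i => A i ω) ∘ₗ N)) ∧
            ∀ N, LowRankMap.IsPosDefRankPreserver N →
              LowRankMap.IsNormalized (LowRankMap.ofComponents (fun i => A i ω) ∘ₗ N) →
              LowRankMap.ricConst (LowRankMap.ofComponents (fun i => A i ω) ∘ₗ N) (4 * r) ≤ δ ∧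
              (d ≤ q ^ 2 →
                LowRankMap.opNorm (LowRankMap.ofComponents (fun i => A i ω) ∘ₗ N)
                  ≤ √(5 * (q : ℝ) ^ 2 / d)) := by
  set ε := δ / 5000 with hε
  have hε0 : 0 < ε := by positivity
  have hε1 : ε ≤ 1 / 5000 := by linarith
  set l := Real.log (1 + 16 / ε) with hl
  have hl0 : 0 < l := Real.log_pos (by linarith [show 0 < 16 / ε by positivity])
  -- c₁ encodes the net condition 2 · q · 4r · l ≤ (ε²/16) d. The failure probabilities add up to at
  -- most 3 exp(-c₃d), and c₂ = 4 makes the final inequality strict.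
  refine ⟨128 * l / ε ^ 2, 4, ε ^ 2 / 16, by positivity, by norm_num, by positivity, ?_⟩
  intro q r d hq hr hd Ω _ P _ A hlaw hind
  have hq' : (1 : ℝ) ≤ q := by exact_mod_cast hq
  have hr' : (1 : ℝ) ≤ r := by exact_mod_cast hr
  have hlogq : 0 ≤ Real.log q := Real.log_nonneg hq'
  have hqr : 128 * l / ε ^ 2 * (q * r) ≤ d := by
    refine le_trans ?_ hd
    rw [mul_assoc]
    gcongr
    linarith
  have hd1 : 1 ≤ d := by
    have : (0 : ℝ) < d := lt_of_lt_of_le (by positivity) hqr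
    exact_mod_cast this
  have hY := LowRankMap.hasLaw_gaussianArray 
    (f := fun (s : Fin d × Fin q × Fin q) ω => A s.1 ω s.2.1 s.2.2)
    (fun s => hlaw s.1 s.2.1 s.2.2) hind
  have hrip := LowRankMap.measure_not_isRestrictedIsometryBound_le (q := q) (k := 4 * r) hd1 hε0
    (by linarith) (by
      rw [← hl]
      push_cast
      rw [div_mul_eq_mul_div, div_le_iff₀ (by positivity)] at hqr
      linarith)
  have hη : 5 * ε = δ / 1000 := by rw [hε]; ring
  rw [hη] at hrip
  have hbad : gaussianArray (Fin d) (Fin q × Fin q) (1 / (d : ℝ≥0))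
      {g | ¬ (LowRankMap.IsRestrictedIsometryBound (LowRankMap.arrayMap g) (4 * r) (δ / 1000) ∧
        (d ≤ q ^ 2 → ∀ X : Matrix (Fin q) (Fin q) ℝ, ‖LowRankMap.arrayMap g X‖ ^ 2 ≤
          4.95 * (q : ℝ) ^ 2 / d * @norm _ Matrix.frobeniusNormedAddCommGroup.toNorm X ^ 2))} ≤
      ENNReal.ofReal (3 * Real.exp (-(ε ^ 2 / 16) * d)) := by
    have hsum : (3 : ℝ) * Real.exp (-(ε ^ 2 / 16) * d) =
        2 * Real.exp (-(ε ^ 2 / 16) * d) + Real.exp (-(ε ^ 2 / 16) * d) := by ring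
    rw [hsum, ENNReal.ofReal_add (by positivity) (Real.exp_nonneg _)]
    by_cases hdq : d ≤ q ^ 2
    · have hop := LowRankMap.measure_not_norm_sq_arrayMap_le hd1 hdq
      have hexp : Real.exp (-(1 / 200) * d) ≤ Real.exp (-(ε ^ 2 / 16) * d) := by
        apply Real.exp_le_exp.2
        have : ε ^ 2 / 16 ≤ 1 / 200 := by nlinarith
        exact mul_le_mul_of_nonneg_right (neg_le_neg this) (Nat.cast_nonneg d)
      refine (measure_mono ?_).trans ((measure_union_le _ _).trans
        (add_le_add hrip (hop.trans (ENNReal.ofReal_le_ofReal hexp))))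
      intro g hg
      rw [Set.mem_ofPred_eq, not_and_or] at hg
      exact hg.imp id fun h => fun h' => h fun _ => h'
    · refine (measure_mono fun g hg => ?_).trans (hrip.trans le_self_add)
      exact fun h => hg ⟨h, fun h' => absurd h' hdq⟩
  obtain ⟨E, hE, hPE, hgood⟩ :=
    LowRankMap.exists_measurableSet_of_hasLaw hY (by positivity) hbad
  refine ⟨E, hE, ?_, fun ω hω => ?_⟩
  · have := Real.exp_pos (-(ε ^ 2 / 16) * d)
    linarith
  · obtain ⟨hR, hO⟩ := hgood ω hω
    have hmap : LowRankMap.arrayMap (fun i (p : Fin q × Fin q) => A i ω p.1 p.2) =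
        LowRankMap.ofComponents fun i => A i ω := rfl
    rw [hmap] at hR hO
    have hone := LowRankMap.isRankOneNearIsometry_of_isRestrictedIsometryBound (by omega) hR
    refine ⟨LowRankMap.exists_isNormalized_comp hq hone (by linarith), fun N hN hnorm => ?_⟩
    have hprop := LowRankMap.normalized_comp_properties hq (by omega) hδ0 hδ1 hR hN hnorm
    exact ⟨hprop.1, fun hdq => hprop.2 (hO hdq)⟩
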